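/- Let $m\ge 0$ and let $\mathbb B^m$ be the open Euclidean unit ball of $\mathbb C^m$, with $\langle z,w\rangle=\sum_i z_i\bar w_i$. Let $K:\mathbb B^m\times\mathbb B^m\to\mathbb C$ be a positive definite kernel (that is, Hermitian with $\sum_{a,b}\bar c_aK(w_a,w_b)c_b\ge 0$ for all finite families of points and scalars), holomorphic in the first and anti-holomorphic in the second variable, with $K(w,w)\ne 0$ for all $w\in\mathbb B^m$. Let $\mathcal H_K$ be its reproducing kernel Hilbert space, and assume that the multiplication operators $M_i f=z_if$ are bounded on $\mathcal H_K$ and that the tuple of adjoints $\boldsymbol M^*=(M_1^*,\dots,M_m^*)$ belongs to the Cowen–Douglas class $B_1(\mathbb B^m)$: the operators commute and, with $D_w x=((M_1^*-w_1)x,\dots,(M_m^*-w_m)x)$, the range of $D_w$ is closed and $\dim\ker D_w=1$ for every $w\in\mathbb B^m$, and the span of the spaces $\ker D_w$, $w\in\mathbb B^m$, is dense in $\mathcal H_K$. Call a matrix-valued function $G$ on $\mathbb B^m$ a *positive definite function* if there is $\tilde G:\mathbb B^m\times\mathbb B^m\to\mathbb C^{m\times m}$, holomorphic in the first and anti-holomorphic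 in the second variable, with $\tilde G(w,w)=G(w)$ and $\sum_{a,b}\langle\tilde G(w_a,w_b)\xi_b,\xi_a\rangle\ge 0$ for all finite families of points $w_a\in\mathbb B^m$ and vectors $\xi_a\in\mathbb C^m$; write $G_1\preceq G_2$ if $G_2-G_1$ is a positive definite function. For a tuple $\boldsymbol T$ whose joint eigenspaces $\bigcap_i\ker(T_i-w_i)$ are one-dimensional and have a nowhere vanishing holomorphic section $\gamma$ near each $w\in\mathbb B^m$, let $\mathsf K_{\boldsymbol T}(w)=\big(-\tfrac{\partial^2}{\partial w_i\partial\bar w_j}\log\|\gamma(w)\|^2\big)_{i,j=1}^m$ be its curvature matrix. Let $\boldsymbol R_m$ be the tuple of multiplications by the coordinate functions on the Drury–Arveson space $H^2_m$, the reproducing kernel Hilbert space on $\mathbb B^m$ with kernel $(1-\langle z,w\rangle)^{-1}$. Then the following are equivalent: (i) the function $w\mapsto\big(\tfrac{\partial^2}{\partial w_i\partial\bar w_j}\log\big((1-\langle w,w\rangle)K(w,w)\big)\big)_{i,j=1}^m$ is a positive definite function on $\mathbb B^m$; (ii) $\mathsf K_{\boldsymbol M^*}\preceq\mathsf K_{\boldsymbol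 R_m^*}$ on $\mathbb B^m$; (iii) $\boldsymbol M$ is an infinitely divisible row contraction, that is, the kernel $L(z,w)=(1-\langle z,w\rangle)K(z,w)$ is infinitely divisible: it has a logarithm $\log L$ on $\mathbb B^m\times\mathbb B^m$ that is holomorphic in the first variable, anti-holomorphic in the second and real on the diagonal, and for every $t>0$ the kernel $L^t=\exp(t\log L)$ is positive definite. -/

import Mathlib

open scoped ComplexOrder ComplexConjugate

noncomputable section

namespace CowenDouglas

/-- The Hermitian space `ℂᵐ`. -/
abbrev Cn (m : ℕ) : Type := EuclideanSpace ℂ (Fin m)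

/-- The open Euclidean unit ball `𝔹ᵐ` of `ℂᵐ`. -/
abbrev unitBall (m : ℕ) : Set (Cn m) := Metric.ball 0 1

/-- Coordinatewise complex conjugation on `ℂᵐ`. -/
def conjVec {m : ℕ} (w : Cn m) : Cn m := WithLp.toLp 2 fun i => conj (w i)

/-- `F(z, w)` is holomorphic in `z` and anti-holomorphic in `w` on `Ω × Ω`, that is,
`(z, w) ↦ F(z, w̄)` is holomorphic on `Ω × Ω*`, where `Ω* = {w : w̄ ∈ Ω}`. -/
def SesquiHolomorphicOn {m : ℕ} (Ω : Set (Cn m)) (F : Cn m → Cn m → ℂ) : Prop :=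
  DifferentiableOn ℂ (fun p : Cn m × Cn m => F p.1 (conjVec p.2)) (Ω ×ˢ (conjVec ⁻¹' Ω))

/-! ### Positive definiteness -/

/-- A scalar kernel is positive definite on `Ω`: it is Hermitian and
`∑ conj(c_i) K(w_i, w_j) c_j ≥ 0` for all finitely supported families of scalars. -/
def IsPosDefKernel {m : ℕ} (Ω : Set (Cn m)) (K : Cn m → Cn m → ℂ) : Prop :=
  (Matrix.of fun z w : Ω => K z w).PosSemidef

/-- A matrix valued kernel is positive definite on `Ω`:
`∑ ⟨F(w_a, w_b) ξ_b, ξ_a⟩ ≥ 0` for all finite families of points of `Ω` and vectors. -/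
def IsPosDefMatrixKernel {m k : ℕ} (Ω : Set (Cn m))
    (F : Cn m → Cn m → Matrix (Fin k) (Fin k) ℂ) : Prop :=
  (Matrix.of fun p q : Ω × Fin k => F p.1 q.1 p.2 q.2).PosSemidef

/-- A matrix valued function `G` of one variable is a *positive definite function* on `Ω`:
its polarization (the function on `Ω × Ω` which is holomorphic in the first and anti-holomorphic
in the second variable and restricts to `G` on the diagonal) is a positive definite kernel. -/
def IsPosDefFunction {m k : ℕ} (Ω : Set (Cn m))
    (G : Cn m → Matrix (Fin k) (Fin k) ℂ) : Prop :=
  ∃ F : Cn m → Cn m → Matrix (Fin k) (Fin k) ℂ,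
    (∀ i j, SesquiHolomorphicOn Ω fun z w => F z w i j) ∧
    (∀ w ∈ Ω, F w w = G w) ∧
    IsPosDefMatrixKernel Ω F

/-- The order `G₁ ⪯ G₂` on `Ω`: the difference `G₂ - G₁` is a positive definite function. -/
def PrecOn {m k : ℕ} (Ω : Set (Cn m)) (G₁ G₂ : Cn m → Matrix (Fin k) (Fin k) ℂ) : Prop :=
  IsPosDefFunction Ω fun w => G₂ w - G₁ w

/-- A kernel `L` is infinitely divisible on `Ω`: for every `t > 0` the power
`L^t = exp (t log L)` is a positive definite kernel. Here `log L` is the logarithm of `L` which is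
holomorphic in the first and anti-holomorphic in the second variable and which is
real on the diagonal; on a nonempty connected open set it is unique if it exists. -/
def IsInfinitelyDivisible {m : ℕ} (Ω : Set (Cn m)) (L : Cn m → Cn m → ℂ) : Prop :=
  ∃ logL : Cn m → Cn m → ℂ,
    SesquiHolomorphicOn Ω logL ∧
    (∀ w ∈ Ω, (logL w w).im = 0) ∧
    (∀ z ∈ Ω, ∀ w ∈ Ω, Complex.exp (logL z w) = L z w) ∧
    ∀ t : ℝ, 0 < t → IsPosDefKernel Ω fun z w => Complex.exp ((t : ℂ) * logL z w)

/-! ### Wirtinger derivatives -/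

/-- The operator `∂/∂w_i`. -/
def dW {m : ℕ} (i : Fin m) (f : Cn m → ℂ) (w : Cn m) : ℂ :=
  (1 / 2 : ℂ) * (fderiv ℝ f w (EuclideanSpace.single i 1)
    - Complex.I * fderiv ℝ f w (EuclideanSpace.single i Complex.I))

/-- The operator `∂/∂w̄_j`. -/
def dWbar {m : ℕ} (j : Fin m) (f : Cn m → ℂ) (w : Cn m) : ℂ :=
  (1 / 2 : ℂ) * (fderiv ℝ f w (EuclideanSpace.single j 1)
    + Complex.I * fderiv ℝ f w (EuclideanSpace.single j Complex.I))

/-- The matrix `(∂² log g / ∂w_i ∂w̄_j)` of a positive function `g`. -/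
def hessLog {m : ℕ} (g : Cn m → ℝ) (w : Cn m) : Matrix (Fin m) (Fin m) ℂ :=
  Matrix.of fun i j => dW i (dWbar j fun v => ((Real.log (g v) : ℝ) : ℂ)) w

/-! ### Commuting tuples of operators, the Cowen-Douglas class, curvature -/

section Tuples

variable {m : ℕ} {H : Type*} [NormedAddCommGroup H] [InnerProductSpace ℂ H]

/-- The operator `D_{T - w} x = ((T₁ - w₁) x, …, (T_m - w_m) x)`. -/
def jointD (T : Fin m → H →L[ℂ] H) (w : Cn m) : H →L[ℂ] (Fin m → H) :=
  ContinuousLinearMap.pi fun i => T i - w i • ContinuousLinearMap.id ℂ H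

/-- The joint kernel `⋂ ker (T_i - w_i)`. -/
def jointKer (T : Fin m → H →L[ℂ] H) (w : Cn m) : Submodule ℂ H :=
  LinearMap.ker (jointD T w : H →ₗ[ℂ] (Fin m → H))

/-- The Cowen-Douglas class `B_n(Ω)` of commuting tuples of operators. -/
structure MemCowenDouglas (n : ℕ) (Ω : Set (Cn m)) (T : Fin m → H →L[ℂ] H) : Prop where
  commute : ∀ i j, Commute (T i) (T j)
  closed_range : ∀ w ∈ Ω, IsClosed (Set.range (jointD T w))
  rank_ker : ∀ w ∈ Ω, Module.rank ℂ (jointKer T w) = n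
  dense_span : (⨆ w ∈ Ω, jointKer T w).topologicalClosure = ⊤

/-- `γ` is a nowhere vanishing holomorphic section over the open set `U` of the bundle with
fibre `⋂ ker (T_i - w_i)` at `w`. -/
structure IsHolomorphicSection (T : Fin m → H →L[ℂ] H) (U : Set (Cn m)) (γ : Cn m → H) :
    Prop where
  isOpen : IsOpen U
  holomorphic : DifferentiableOn ℂ γ U
  ne_zero : ∀ w ∈ U, γ w ≠ 0
  mem_ker : ∀ w ∈ U, γ w ∈ jointKer T w

/-- `T` has a nowhere vanishing holomorphic section near `w`. -/
def HasLocalSection (T : Fin m → H →L[ℂ] H) (w : Cn m) : Prop :=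
  ∃ γ : Cn m → H, ∃ U : Set (Cn m), w ∈ U ∧ IsHolomorphicSection T U γ

open scoped Classical in
/-- The curvature matrix `𝖪_T(w) = (-∂² log ‖γ(w)‖² / ∂w_i ∂w̄_j)` of a tuple `T`, where `γ` is
any nowhere vanishing holomorphic section defined near `w` (for a line bundle the value does not
depend on the section). -/
def curvatureMatrix (T : Fin m → H →L[ℂ] H) (w : Cn m) : Matrix (Fin m) (Fin m) ℂ :=
  if h : HasLocalSection T w then -hessLog (fun v => ‖h.choose v‖ ^ 2) w else 0

/-- The tuple of adjoints. -/
def adjointTuple [CompleteSpace H] (T : Fin m → H →L[ℂ] H) : Fin m → H →L[ℂ] H :=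
  fun i => ContinuousLinearMap.adjoint (T i)

variable {Ω : Set (Cn m)} [RKHS ℂ H Ω ℂ]

/-- `T` is the operator `f ↦ z_i f` of multiplication by the `i`-th coordinate function. -/
def IsCoordMul (i : Fin m) (T : H →L[ℂ] H) : Prop :=
  ∀ (f : H) (z : Ω), T f z = (z : Cn m) i * f z

end Tuples

/-! ### The reproducing kernel Hilbert space of a positive definite kernel -/

/-- A scalar kernel on `Ω`, in the form of an operator valued kernel. -/
def opKernel {m : ℕ} (Ω : Set (Cn m)) (K : Cn m → Cn m → ℂ) : Matrix Ω Ω (ℂ →L[ℂ] ℂ) :=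
  Matrix.of fun z w => K z w • ContinuousLinearMap.id ℂ ℂ

theorem IsPosDefKernel.opKernel {m : ℕ} {Ω : Set (Cn m)} {K : Cn m → Cn m → ℂ}
    (hK : IsPosDefKernel Ω K) : Fact (opKernel Ω K).PosSemidef := by
  have hH : ∀ z w : Ω, conj (K w z) = K z w := fun z w => hK.1.apply z w
  have hT := (RKHS.posSemidef_tfae (K := CowenDouglas.opKernel Ω K)).out 2 0
  refine ⟨hT.mp ⟨?_, fun vv => ?_⟩⟩
  · ext z w
    simp [CowenDouglas.opKernel, Matrix.conjTranspose_apply, ContinuousLinearMap.star_eq_adjoint,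
      hH, show ContinuousLinearMap.adjoint (ContinuousLinearMap.id ℂ ℂ) =
        ContinuousLinearMap.id ℂ ℂ from ContinuousLinearMap.adjoint_id]
  · have h := (Complex.le_def.mp (hK.2 vv)).1
    refine le_of_le_of_eq h ?_
    simp only [Finsupp.sum]
    congr 1
    refine Finset.sum_congr rfl fun x _ => Finset.sum_congr rfl fun y _ => ?_
    simp [CowenDouglas.opKernel, hH]
    ring

/-- The reproducing kernel Hilbert space `H_K` of functions on `Ω` with kernel `K`. -/
def KernelSpace {m : ℕ} (Ω : Set (Cn m)) (K : Cn m → Cn m → ℂ) (hK : IsPosDefKernel Ω K) : Type :=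
  haveI := hK.opKernel
  RKHS.OfKernel (opKernel Ω K)

namespace KernelSpace

variable {m : ℕ} {Ω : Set (Cn m)} {K : Cn m → Cn m → ℂ} {hK : IsPosDefKernel Ω K}

instance : NormedAddCommGroup (KernelSpace Ω K hK) :=
  haveI := hK.opKernel
  inferInstanceAs (NormedAddCommGroup (RKHS.OfKernel (opKernel Ω K)))

instance : InnerProductSpace ℂ (KernelSpace Ω K hK) :=
  haveI := hK.opKernel
  inferInstanceAs (InnerProductSpace ℂ (RKHS.OfKernel (opKernel Ω K)))

instance : CompleteSpace (KernelSpace Ω K hK) :=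
  haveI := hK.opKernel
  inferInstanceAs (CompleteSpace (RKHS.OfKernel (opKernel Ω K)))

instance : RKHS ℂ (KernelSpace Ω K hK) Ω ℂ :=
  haveI := hK.opKernel
  inferInstanceAs (RKHS ℂ (RKHS.OfKernel (opKernel Ω K)) Ω ℂ)

/-- The reproducing kernel of `H_K` is `K`. -/
theorem kernel_apply (z w : Ω) : RKHS.kernel (KernelSpace Ω K hK) z w 1 = K z w := by
  have := hK.opKernel
  have h : RKHS.kernel (KernelSpace Ω K hK) = opKernel Ω K :=
    RKHS.OfKernel.kernel_ofKernel (K := opKernel Ω K)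
  rw [h]
  simp [opKernel]

end KernelSpace

theorem KernelSpace.inner_kerFun_kerFun {m : ℕ} {Ω : Set (Cn m)} {K : Cn m → Cn m → ℂ}
    (hK : IsPosDefKernel Ω K) (z w : Ω) :
    inner ℂ (RKHS.kerFun (KernelSpace Ω K hK) z 1) (RKHS.kerFun (KernelSpace Ω K hK) w 1) =
      K z w := by
  rw [RKHS.kerFun_inner, RKHS.kerFun_apply, KernelSpace.kernel_apply]
  simp

/-- If `(1 - z_i w̄_i) K(z, w)` is positive definite, multiplication by `z_i` is bounded on `H_K`. -/
theorem exists_isCoordMul {m : ℕ} {Ω : Set (Cn m)} {K : Cn m → Cn m → ℂ}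
    (hK : IsPosDefKernel Ω K) (i : Fin m)
    (h : IsPosDefKernel Ω fun z w => (1 - z i * conj (w i)) * K z w) :
    ∃ T : KernelSpace Ω K hK →L[ℂ] KernelSpace Ω K hK, IsCoordMul i T := by
  let k : Ω → KernelSpace Ω K hK := fun w => RKHS.kerFun (KernelSpace Ω K hK) w 1
  let e : (Ω →₀ ℂ) →ₗ[ℂ] KernelSpace Ω K hK := Finsupp.linearCombination ℂ k
  let f : (Ω →₀ ℂ) →ₗ[ℂ] KernelSpace Ω K hK :=
    Finsupp.linearCombination ℂ fun w : Ω => conj ((w : Cn m) i) • k w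
  have hd : DenseRange e := by
    have h1 := RKHS.kerFun_dense (KernelSpace Ω K hK)
    have h2 : Submodule.span ℂ {x | ∃ (w : Ω) (v : ℂ),
        RKHS.kerFun (KernelSpace Ω K hK) w v = x} ≤ LinearMap.range e := by
      rw [Submodule.span_le]
      rintro _ ⟨w, v, rfl⟩
      refine ⟨Finsupp.single w v, ?_⟩
      simp only [e, k, Finsupp.linearCombination_single, ← map_smul, smul_eq_mul, mul_one]
    have h3 : (LinearMap.range e).topologicalClosure = ⊤ :=
      top_le_iff.mp (h1 ▸ Submodule.topologicalClosure_mono h2)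
    exact Submodule.dense_iff_topologicalClosure_eq_top.mpr h3
  have hn : ∀ c, ‖f c‖ ≤ 1 * ‖e c‖ := by
    intro c
    rw [one_mul]
    refine le_of_sq_le_sq ?_ (norm_nonneg _)
    have hp := (Complex.le_def.mp (h.2 c)).1
    have key : (c.sum fun z cz => c.sum fun w cw => star cz *
        (Matrix.of fun z w : Ω => (1 - (z : Cn m) i * conj ((w : Cn m) i)) * K z w) z w * cw) =
        inner ℂ (e c) (e c) - inner ℂ (f c) (f c) := by
      simp only [e, f, Finsupp.linearCombination_apply, Finsupp.sum, sum_inner, inner_sum,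
        inner_smul_left, inner_smul_right, k, KernelSpace.inner_kerFun_kerFun,
        ← Finset.sum_sub_distrib, Finset.mul_sum]
      try rw [Finset.sum_comm]
      refine Finset.sum_congr rfl fun z _ => Finset.sum_congr rfl fun w _ => ?_
      simp
      ring
    rw [key] at hp
    have h4 : ∀ x : KernelSpace Ω K hK, (inner ℂ x x).re = ‖x‖ ^ 2 := fun x =>
      inner_self_eq_norm_sq (𝕜 := ℂ) x
    simp only [Complex.zero_re, Complex.sub_re, h4] at hp
    linarith
  refine ⟨ContinuousLinearMap.adjoint (f.extendOfNorm e), fun g z => ?_⟩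
  have hz : f.extendOfNorm e (k z) = conj ((z : Cn m) i) • k z := by
    have := LinearMap.extendOfNorm_eq hd ⟨1, hn⟩ (Finsupp.single z 1)
    simpa [e, f] using this
  have hev : ∀ g : KernelSpace Ω K hK, g z = inner ℂ (k z) g := fun g => by
    simp only [k, RKHS.kerFun_inner]
    simp
  rw [hev, ContinuousLinearMap.adjoint_inner_right, hz, inner_smul_left, ← hev]
  simp

/-! ### The Drury-Arveson space and shift, infinitely divisible row contractions -/

/-- The Drury-Arveson kernel `1 / (1 - ⟨z, w⟩)`, with `⟨z, w⟩ = ∑ z_i conj(w_i)`. -/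
def druryArvesonKernel (m : ℕ) (z w : Cn m) : ℂ := (1 - inner ℂ w z)⁻¹

theorem isPosDefKernel_druryArveson (m : ℕ) :
    IsPosDefKernel (unitBall m) (druryArvesonKernel m) := by
  have h1 : (Matrix.of fun z w : unitBall m => inner ℂ (w : Cn m) (z : Cn m)).PosSemidef := by
    refine ⟨by ext z w; simp [Matrix.conjTranspose_apply], fun x => ?_⟩
    have h : 0 ≤ inner ℂ (x.sum fun z c => conj c • (z : Cn m))
        (x.sum fun z c => conj c • (z : Cn m)) := by
      rw [inner_self_eq_norm_sq_to_K]
      rw [← RCLike.ofReal_pow]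
      exact RCLike.ofReal_nonneg.mpr (sq_nonneg _)
    refine le_of_le_of_eq h ?_
    simp only [Finsupp.sum, sum_inner, inner_sum, inner_smul_left, inner_smul_right,
      Finset.mul_sum]
    refine Finset.sum_congr rfl fun i _ => Finset.sum_congr rfl fun j _ => ?_
    simp
    ring
  have h2 : ∀ n : ℕ,
      (Matrix.of fun z w : unitBall m => inner ℂ (w : Cn m) (z : Cn m) ^ n).PosSemidef := by
    intro n
    induction n with
    | zero =>
      refine ⟨by ext z w; simp [Matrix.conjTranspose_apply], fun x => ?_⟩
      refine le_of_le_of_eq (star_mul_self_nonneg (x.sum fun _ c => c)) ?_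
      simp [Finsupp.sum, Finset.sum_mul_sum]
    | succ n ih =>
      exact ih.hadamard h1
  have hlim : ∀ z w : unitBall m, HasSum (fun n : ℕ => inner ℂ (w : Cn m) (z : Cn m) ^ n)
      (druryArvesonKernel m z w) := by
    intro z w
    refine hasSum_geometric_of_norm_lt_one ?_
    have hz : ‖(z : Cn m)‖ < 1 := mem_ball_zero_iff.mp z.2
    have hw : ‖(w : Cn m)‖ < 1 := mem_ball_zero_iff.mp w.2
    calc _ ≤ ‖(w : Cn m)‖ * ‖(z : Cn m)‖ := norm_inner_le_norm _ _
      _ < 1 := by nlinarith [norm_nonneg (z : Cn m), norm_nonneg (w : Cn m)]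
  refine ⟨by ext z w; simp [Matrix.conjTranspose_apply, druryArvesonKernel], fun x => ?_⟩
  have hs : HasSum (fun n : ℕ => x.sum fun i xi => x.sum fun j xj =>
      star xi * inner ℂ (j : Cn m) (i : Cn m) ^ n * xj)
      (x.sum fun i xi => x.sum fun j xj => star xi * druryArvesonKernel m i j * xj) :=
    hasSum_sum fun i _ => hasSum_sum fun j _ => ((hlim i j).mul_left _).mul_right _
  exact hs.nonneg fun n => (h2 n).2 x

/-- The Drury-Arveson space `H²_m`. -/
abbrev DruryArveson (m : ℕ) : Type :=
  KernelSpace (unitBall m) (druryArvesonKernel m) (isPosDefKernel_druryArveson m)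

theorem exists_isCoordMul_druryArveson (m : ℕ) (i : Fin m) :
    ∃ T : DruryArveson m →L[ℂ] DruryArveson m, IsCoordMul i T := by
  apply exists_isCoordMul
  have hA := isPosDefKernel_druryArveson m
  have h1 : IsPosDefKernel (unitBall m) fun _ _ => 1 := by
    refine ⟨by ext z w; simp [Matrix.conjTranspose_apply], fun x => ?_⟩
    refine le_of_le_of_eq (star_mul_self_nonneg (x.sum fun _ c => c)) ?_
    simp [Finsupp.sum, Finset.sum_mul_sum]
  have h2 : ∀ j : Fin m, IsPosDefKernel (unitBall m)
      fun z w => (z j * conj (w j)) * druryArvesonKernel m z w := by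
    intro j
    have h : IsPosDefKernel (unitBall m) fun z w => z j * conj (w j) := by
      refine ⟨by ext z w; simp [Matrix.conjTranspose_apply, mul_comm], fun x => ?_⟩
      refine le_of_le_of_eq
        (star_mul_self_nonneg (x.sum fun z c => conj ((z : Cn m) j) * c)) ?_
      simp only [Finsupp.sum, star_sum, Finset.sum_mul_sum]
      refine Finset.sum_congr rfl fun z _ => Finset.sum_congr rfl fun w _ => ?_
      simp
      ring
    exact h.hadamard hA
  have h3 := h1.add (Matrix.posSemidef_sum (Finset.univ.erase i) fun j _ => h2 j)
  unfold IsPosDefKernel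
  convert h3 using 1
  ext z w
  have hz : ‖(z : Cn m)‖ < 1 := mem_ball_zero_iff.mp z.2
  have hw : ‖(w : Cn m)‖ < 1 := mem_ball_zero_iff.mp w.2
  have hne : (1 - inner ℂ (w : Cn m) (z : Cn m)) ≠ 0 := by
    intro h0
    have h5 : inner ℂ (w : Cn m) (z : Cn m) = 1 := (sub_eq_zero.mp h0).symm
    have h6 := norm_inner_le_norm (𝕜 := ℂ) (w : Cn m) (z : Cn m)
    rw [h5] at h6
    simp only [norm_one] at h6
    nlinarith [norm_nonneg (z : Cn m), norm_nonneg (w : Cn m)]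
  have hin : inner ℂ (w : Cn m) (z : Cn m) =
      (z : Cn m) i * conj ((w : Cn m) i) +
        ∑ j ∈ Finset.univ.erase i, (z : Cn m) j * conj ((w : Cn m) j) := by
    rw [Finset.add_sum_erase _ (fun j => (z : Cn m) j * conj ((w : Cn m) j)) (Finset.mem_univ i),
      PiLp.inner_apply]
    simp
  simp only [Matrix.add_apply, Matrix.sum_apply, Matrix.of_apply, ← Finset.sum_mul,
    druryArvesonKernel]
  field_simp
  rw [hin]
  ring

/-- The Drury-Arveson shift `R_m`: multiplication by the coordinate functions on `H²_m`. -/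
def druryArvesonShift (m : ℕ) (i : Fin m) : DruryArveson m →L[ℂ] DruryArveson m :=
  (exists_isCoordMul_druryArveson m i).choose

theorem isCoordMul_druryArvesonShift (m : ℕ) (i : Fin m) : IsCoordMul i (druryArvesonShift m i) :=
  (exists_isCoordMul_druryArveson m i).choose_spec

/-- The tuple of coordinate multiplications on the space `H_K` over the ball is an infinitely
divisible row contraction: the kernel `(1 - ⟨z, w⟩) K(z, w)` is infinitely divisible. -/
def IsInfinitelyDivisibleRowContraction {m : ℕ} (K : Cn m → Cn m → ℂ) : Prop :=
  IsInfinitelyDivisible (unitBall m) fun z w => (1 - inner ℂ w z) * K z w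

end CowenDouglas

end

/-! Put L(z, w) = (1 - ⟨z, w⟩) K(z, w); it is Hermitian, sesquiholomorphic and positive on the
diagonal. If ψ is a logarithm of L, then the complex Hessian of log L(w, w) has as polarization the
matrix of mixed derivatives ∂²ψ/∂z_i ∂w̄_j (`hessLog_eq_mixedDeriv`). The equivalence of (i) and
(iii) is thus about passing between ψ and its mixed derivatives.

From (iii) to (i): the limit of (L^t - 1)/t as t → 0 shows that ψ is positive on coefficient
families of sum zero (`sum_nonneg_of_exp`). Testing this on pairs of points x_a + s v_a and x_a with
weights 1/s and -1/s yields second difference quotients, whose limits are the mixed derivatives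
(`isPosDefMatrixKernel_mixedMatrix`).

From (i) to (iii): the polarization F is integrated along rays in both variables, P(z, w) = ∑ z_i
w̄_j ∫∫ F_ij(sz, tw) ds dt. Integrating Gram vectors of F shows that P is a positive definite kernel
(`isPosDefKernel_doublePrimitive`). Near the origin the fundamental theorem of calculus gives P =
ψ(z, w) - ψ(z, 0) - ψ(0, w) + ψ(0, 0) (`doublePrimitive_eq`). After exponentiation this is an
identity between functions holomorphic on the whole product, so the identity theorem makes it
global: exp(P) L(z, 0) L(0, w) = L(z, w) L(0, 0). Hence L(z, 0) never vanishes and has a logarithm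
on the ball, so L has one too, and L^t is exp(tP) times a rank one kernel. The Schur product theorem
finishes the argument (`isInfinitelyDivisible_of_isPosDefFunction`).

Condition (ii) is a translation of (i). The joint eigenspace of the adjoints at v is spanned by the
kernel function at v̄, which depends holomorphically on v because its Gram kernel is
sesquiholomorphic (`differentiableAt_of_inner_eq`). Any other section differs by a holomorphic
factor c, and log |c|² has zero complex Hessian, so the curvature is minus the transposed Hessian of
log K at v̄ (`curvatureMatrix_adjointTuple`). For the Drury-Arveson shift the eigenspaces are found
from the formula for ∑ R_i R_i^* (`sum_druryArvesonShift_adjoint`). The difference of the curvatures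
is the transposed Hessian of log L at w̄, and G ↦ G(w̄)ᵀ preserves positive definite functions
(`IsPosDefFunction.conj_transpose`). -/

namespace SeveralComplexVariables

open Metric Set Filter Topology

/-! ### Cauchy estimates and smoothness of holomorphic maps between normed spaces -/

section Cauchy

variable {E F : Type*} [NormedAddCommGroup E] [NormedSpace ℂ E]
  [NormedAddCommGroup F] [NormedSpace ℂ F]

/-- Cauchy's estimate for the derivative at the center of a ball. -/
theorem norm_fderiv_le_of_ball {f : E → F} {c : E} {r M : ℝ} (hr : 0 < r)
    (hf : DifferentiableOn ℂ f (ball c r)) (hM : ∀ x ∈ ball c r, ‖f x - f c‖ ≤ M) :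
    ‖fderiv ℂ f c‖ ≤ M / r :=
  Complex.norm_fderiv_le_div_of_mapsTo_ball hf
    (fun x hx => by simpa [dist_eq_norm] using hM x hx) hr

/-- Cauchy's estimate is recentred at x, where a ball of radius r still fits into the large ball;
measuring oscillation from f x instead of f c costs the factor 2. -/
theorem norm_fderiv_le_of_mem_ball {f : E → F} {c x : E} {r M : ℝ}
    (hf : DifferentiableOn ℂ f (ball c (2 * r))) (hM : ∀ x ∈ ball c (2 * r), ‖f x - f c‖ ≤ M)
    (hx : x ∈ ball c r) : ‖fderiv ℂ f x‖ ≤ 2 * M / r := by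
  have hr : 0 < r := pos_of_mem_ball hx
  have hsub : ball x r ⊆ ball c (2 * r) := by
    refine ball_subset_ball' ?_
    have := mem_ball.mp hx
    linarith
  refine norm_fderiv_le_of_ball hr (hf.mono hsub) fun y hy => ?_
  have h1 := hM y (hsub hy)
  have h2 := hM x (hsub (mem_ball_self hr))
  calc ‖f y - f x‖ = ‖(f y - f c) - (f x - f c)‖ := by congr 1; abel
    _ ≤ ‖f y - f c‖ + ‖f x - f c‖ := norm_sub_le _ _
    _ ≤ 2 * M := by linarith

theorem norm_image_sub_le_of_mem_ball {f : E → F} {c x y : E} {r M : ℝ}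
    (hf : DifferentiableOn ℂ f (ball c (2 * r))) (hM : ∀ x ∈ ball c (2 * r), ‖f x - f c‖ ≤ M)
    (hx : x ∈ ball c r) (hy : y ∈ ball c r) : ‖f y - f x‖ ≤ 2 * M / r * ‖y - x‖ := by
  have hr : 0 < r := pos_of_mem_ball hx
  let : NormedSpace ℝ E := NormedSpace.restrictScalars ℝ ℂ E
  refine (convex_ball c r).norm_image_sub_le_of_norm_fderiv_le (𝕜 := ℂ) (fun z hz => ?_)
    (fun z hz => norm_fderiv_le_of_mem_ball hf hM hz) hx hy
  exact hf.differentiableAt (isOpen_ball.mem_nhds (ball_subset_ball (by linarith) hz))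

/-- The derivative of a bounded holomorphic map is Lipschitz on a smaller ball. -/
theorem norm_fderiv_sub_le_of_mem_ball {f : E → F} {c x y : E} {r M : ℝ}
    (hf : DifferentiableOn ℂ f (ball c (2 * r))) (hM : ∀ x ∈ ball c (2 * r), ‖f x - f c‖ ≤ M)
    (hx : x ∈ ball c (r / 4)) (hy : y ∈ ball c (r / 4)) :
    ‖fderiv ℂ f y - fderiv ℂ f x‖ ≤ 16 * M / r ^ 2 * ‖y - x‖ := by
  have hr : 0 < r := by have := pos_of_mem_ball hx; linarith
  have hxc := mem_ball_iff_norm.mp hx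
  have hyc := mem_ball_iff_norm.mp hy
  have hb : ∀ z ∈ ball x (r / 4), z ∈ ball c r ∧ z + (y - x) ∈ ball c r := by
    intro z hz
    have hzx := mem_ball_iff_norm.mp hz
    constructor
    · rw [mem_ball_iff_norm]
      calc ‖z - c‖ = ‖(z - x) + (x - c)‖ := by congr 1; abel
        _ ≤ ‖z - x‖ + ‖x - c‖ := norm_add_le _ _
        _ < r := by linarith
    · rw [mem_ball_iff_norm]
      calc ‖z + (y - x) - c‖ = ‖(z - x) + (y - c)‖ := by congr 1; abel
        _ ≤ ‖z - x‖ + ‖y - c‖ := norm_add_le _ _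
        _ < r := by linarith
  have hd : ∀ z ∈ ball c r, DifferentiableAt ℂ f z := fun z hz =>
    hf.differentiableAt (isOpen_ball.mem_nhds (ball_subset_ball (by linarith) hz))
  -- The difference of the two derivatives is the derivative at x of one holomorphic map, the
  -- increment of f by y - x. That increment is O(‖y - x‖), so Cauchy's estimate gives the Lipschitz
  -- bound.
  have hg : DifferentiableOn ℂ (fun z => f (z + (y - x)) - f z) (ball x (r / 4)) := by
    intro z hz
    refine DifferentiableAt.differentiableWithinAt ?_
    refine DifferentiableAt.sub ?_ (hd z (hb z hz).1)
    exact (hd _ (hb z hz).2).comp z (differentiableAt_id.add_const _)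
  have hx4 : x ∈ ball x (r / 4) := mem_ball_self (by linarith)
  have key := norm_fderiv_le_of_ball (M := 4 * M / r * ‖y - x‖) (by linarith) hg fun z hz => by
    have h1 := norm_image_sub_le_of_mem_ball hf hM (hb z hz).1 (hb z hz).2
    have h2 := norm_image_sub_le_of_mem_ball hf hM (hb x hx4).1 (hb x hx4).2
    rw [add_sub_cancel_left] at h1 h2
    refine (norm_sub_le _ _).trans ((add_le_add h1 h2).trans (le_of_eq ?_))
    ring
  have hfd : fderiv ℂ (fun z => f (z + (y - x)) - f z) x = fderiv ℂ f y - fderiv ℂ f x := by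
    rw [fderiv_fun_sub _ (hd x (hb x hx4).1), fderiv_comp_add_right, add_sub_cancel]
    exact (hd _ (hb x hx4).2).comp x (differentiableAt_id.add_const _)
  rw [hfd] at key
  refine key.trans (le_of_eq ?_)
  field_simp
  ring

/-- A holomorphic map is bounded on a ball around each point. -/
theorem exists_ball_bound {f : E → F} {U : Set E} (hU : IsOpen U) (hf : DifferentiableOn ℂ f U)
    {c : E} (hc : c ∈ U) : ∃ r > 0, ball c (2 * r) ⊆ U ∧ ∀ x ∈ ball c (2 * r), ‖f x - f c‖ ≤ 1 := by
  have h1 : ∀ᶠ x in 𝓝 c, x ∈ U ∧ ‖f x - f c‖ < 1 := by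
    refine (hU.eventually_mem hc).and ?_
    have := Metric.tendsto_nhds.mp (hf.continuousOn.continuousAt (hU.mem_nhds hc)) 1 one_pos
    simpa [dist_eq_norm] using this
  obtain ⟨r, hr, h⟩ := Metric.eventually_nhds_iff_ball.mp h1
  refine ⟨r / 2, by linarith, fun x hx => ?_, fun x hx => ?_⟩ <;>
    rw [mul_div_cancel₀ _ (two_ne_zero)] at hx
  exacts [(h x hx).1, (h x hx).2.le]

theorem continuousOn_fderiv {f : E → F} {U : Set E} (hU : IsOpen U)
    (hf : DifferentiableOn ℂ f U) : ContinuousOn (fderiv ℂ f) U := by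
  intro c hc
  refine ContinuousAt.continuousWithinAt ?_
  obtain ⟨r, hr, hsub, hb⟩ := exists_ball_bound hU hf hc
  refine tendsto_iff_norm_sub_tendsto_zero.mpr ?_
  have h0 : Tendsto (fun x => 16 * 1 / r ^ 2 * ‖x - c‖) (𝓝 c) (𝓝 0) := by
    have : Continuous fun x => 16 * 1 / r ^ 2 * ‖x - c‖ := by fun_prop
    simpa using this.tendsto c
  refine squeeze_zero' (Eventually.of_forall fun _ => norm_nonneg _) ?_ h0
  filter_upwards [ball_mem_nhds c (show 0 < r / 4 by linarith)] with x hx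
  exact norm_fderiv_sub_le_of_mem_ball (hf.mono hsub) hb (mem_ball_self (by linarith)) hx

variable [CompleteSpace F]

/-- A uniform limit of holomorphic maps is holomorphic. -/
theorem differentiableAt_of_tendstoUniformlyOn {f : ℕ → E → F} {g : E → F} {c : E} {r : ℝ}
    (hr : 0 < r) (hf : ∀ n, DifferentiableOn ℂ (f n) (ball c (2 * r)))
    (hfg : TendstoUniformlyOn f g atTop (ball c (2 * r))) : DifferentiableAt ℂ g c := by
  -- Cauchy's estimate applied to f m - f n carries the uniform Cauchy property over to the
  -- derivatives.
  have hC : UniformCauchySeqOn (fun n => fderiv ℂ (f n)) atTop (ball c r) := by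
    have h1 := Metric.uniformCauchySeqOn_iff.mp hfg.uniformCauchySeqOn
    rw [Metric.uniformCauchySeqOn_iff]
    intro ε hε
    obtain ⟨N, hN⟩ := h1 (ε * r / 8) (by positivity)
    refine ⟨N, fun m hm n hn x hx => ?_⟩
    have hx2 : ball c r ⊆ ball c (2 * r) := ball_subset_ball (by linarith)
    have hd : ∀ k, DifferentiableAt ℂ (f k) x := fun k =>
      (hf k).differentiableAt (isOpen_ball.mem_nhds (hx2 hx))
    rw [dist_eq_norm, ← fderiv_fun_sub (hd m) (hd n)]
    have hb : ∀ y ∈ ball c (2 * r), ‖f m y - f n y‖ < ε * r / 8 := fun y hy => by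
      simpa [dist_eq_norm] using hN m hm n hn y hy
    have := norm_fderiv_le_of_mem_ball (M := ε * r / 4) ((hf m).sub (hf n)) (fun y hy => by
      refine (norm_sub_le _ _).trans ?_
      have h2 := hb y hy
      have h3 := hb c (mem_ball_self (by linarith))
      simp only [Pi.sub_apply]
      linarith) hx
    refine lt_of_le_of_lt this ?_
    rw [div_lt_iff₀ hr]
    nlinarith
  -- Stated for every x so that `choose` yields a total function; off the ball the value 0 is a
  -- dummy.
  have hlim : ∀ x : E, ∃ φ : E →L[ℂ] F, x ∈ ball c r →
      Tendsto (fun n => fderiv ℂ (f n) x) atTop (𝓝 φ) := by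
    intro x
    by_cases hx : x ∈ ball c r
    · obtain ⟨φ, hφ⟩ := cauchySeq_tendsto_of_complete (hC.cauchy_map hx)
      exact ⟨φ, fun _ => hφ⟩
    · exact ⟨0, fun h => absurd h hx⟩
  choose g' hg' using hlim
  have hU := hC.tendstoUniformlyOn_of_tendsto fun x hx => hg' x hx
  have hn : ball c r ∈ 𝓝 c := ball_mem_nhds c hr
  refine (hasFDerivAt_of_tendstoUniformlyOnFilter (l := atTop) (f := f) (g' := g')
    (f' := fun n => fderiv ℂ (f n)) ?_ ?_ ?_).differentiableAt
  · exact (tendstoUniformlyOn_iff_tendstoUniformlyOnFilter.mp hU).mono_right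
      (le_principal_iff.mpr hn)
  · filter_upwards [(eventually_mem_set.mpr hn).prod_inr atTop] with n hn'
    refine ((hf n.1).differentiableAt (isOpen_ball.mem_nhds ?_)).hasFDerivAt
    exact ball_subset_ball (by linarith) hn'
  · filter_upwards [hn] with x hx
    exact hfg.tendsto_at (ball_subset_ball (by linarith) hx)

/-- Directional derivatives of holomorphic maps are holomorphic. -/
theorem differentiableOn_fderiv_apply {f : E → F} {U : Set E} (hU : IsOpen U)
    (hf : DifferentiableOn ℂ f U) (e : E) : DifferentiableOn ℂ (fun x => fderiv ℂ f x e) U := by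
  intro c hc
  refine DifferentiableAt.differentiableWithinAt ?_
  obtain ⟨r, hr, hsub, hb⟩ := exists_ball_bound hU hf hc
  -- The directional derivative is a uniform limit of difference quotients with steps e / (n + N +
  -- 1). The offset N makes every step shorter than r / 8, so that x + h n stays where the Lipschitz
  -- bound on the derivative holds.
  obtain ⟨N, hN⟩ := exists_nat_gt (8 * ‖e‖ / r)
  have hf' := hf.mono hsub
  set h : ℕ → E := fun n => ((1 : ℂ) / (n + N + 1 : ℂ)) • e with hh
  have hpos : ∀ n : ℕ, (0 : ℝ) < n + N + 1 := fun n => by positivity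
  have hnorm1 : ∀ n : ℕ, ‖(n + N + 1 : ℂ)‖ = n + N + 1 := fun n => by
    have : ((n + N + 1 : ℝ) : ℂ) = (n + N + 1 : ℂ) := by push_cast; ring
    rw [← this, Complex.norm_real, Real.norm_of_nonneg (hpos n).le]
  have hnorm : ∀ n, ‖h n‖ = ‖e‖ / (n + N + 1) := fun n => by
    rw [hh, norm_smul, norm_div, hnorm1, norm_one]; ring
  have hsmall : ∀ n, ‖h n‖ < r / 8 := fun n => by
    rw [hnorm, div_lt_iff₀ (hpos n)]
    rw [div_lt_iff₀ hr] at hN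
    have : (0 : ℝ) ≤ n := n.cast_nonneg
    nlinarith [norm_nonneg e]
  have hmem : ∀ n, ∀ x ∈ ball c (r / 8), x ∈ ball c (r / 4) ∧ x + h n ∈ ball c (r / 4) := by
    intro n x hx
    refine ⟨ball_subset_ball (by linarith) hx, ?_⟩
    rw [mem_ball_iff_norm] at hx ⊢
    calc ‖x + h n - c‖ = ‖(x - c) + h n‖ := by congr 1; abel
      _ ≤ ‖x - c‖ + ‖h n‖ := norm_add_le _ _
      _ < r / 4 := by have := hsmall n; linarith
  have hd : ∀ x ∈ ball c (r / 4), DifferentiableAt ℂ f x := fun x hx =>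
    hf'.differentiableAt (isOpen_ball.mem_nhds (ball_subset_ball (by linarith) hx))
  refine differentiableAt_of_tendstoUniformlyOn
    (f := fun n x => (n + N + 1 : ℂ) • (f (x + h n) - f x)) (r := r / 16) (by linarith) ?_ ?_
  · intro n x hx
    rw [show 2 * (r / 16) = r / 8 by ring] at hx
    refine DifferentiableAt.differentiableWithinAt ?_
    refine DifferentiableAt.const_smul (DifferentiableAt.sub ?_ (hd x (hmem n x hx).1)) _
    exact (hd _ (hmem n x hx).2).comp x (differentiableAt_id.add_const _)
  · rw [show 2 * (r / 16) = r / 8 by ring, Metric.tendstoUniformlyOn_iff]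
    have hest : ∀ n : ℕ, ∀ x ∈ ball c (r / 8),
        ‖(n + N + 1 : ℂ) • (f (x + h n) - f x) - fderiv ℂ f x e‖ ≤
          16 / r ^ 2 * ‖e‖ * ‖e‖ / (n + N + 1) := by
      intro n x hx
      have hmn := hmem n x hx
      let : NormedSpace ℝ E := NormedSpace.restrictScalars ℝ ℂ E
      have hmv := (convex_segment (𝕜 := ℝ) x (x + h n)).norm_image_sub_le_of_norm_fderiv_le'
        (𝕜 := ℂ) (f := f) (φ := fderiv ℂ f x) (C := 16 * 1 / r ^ 2 * ‖h n‖) (fun z hz => hd z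
          ((convex_ball c _).segment_subset hmn.1 hmn.2 hz)) (fun z hz => by
          have hz' := (convex_ball c _).segment_subset hmn.1 hmn.2 hz
          refine (norm_fderiv_sub_le_of_mem_ball hf' hb hmn.1 hz').trans ?_
          refine mul_le_mul_of_nonneg_left ?_ (by positivity)
          simpa using norm_sub_le_of_mem_segment hz)
        (left_mem_segment ℝ _ _) (right_mem_segment ℝ _ _)
      have hne : (n + N + 1 : ℂ) ≠ 0 := by
        rw [← norm_ne_zero_iff, hnorm1]; exact (hpos n).ne'
      have he : fderiv ℂ f x e = (n + N + 1 : ℂ) • fderiv ℂ f x (h n) := by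
        rw [hh, map_smul, smul_smul, mul_one_div_cancel hne, one_smul]
      rw [he, ← smul_sub, norm_smul, hnorm1]
      rw [add_sub_cancel_left, hnorm] at hmv
      refine (mul_le_mul_of_nonneg_left hmv (hpos n).le).trans (le_of_eq ?_)
      have := (hpos n).ne'
      field_simp
    intro ε hε
    have ht : Tendsto (fun n : ℕ => 16 / r ^ 2 * ‖e‖ * ‖e‖ / (n + N + 1 : ℝ)) atTop (𝓝 0) := by
      refine Tendsto.const_div_atTop ?_ _
      refine tendsto_atTop_add_const_right _ _ (tendsto_atTop_add_const_right _ _ ?_)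
      exact tendsto_natCast_atTop_atTop
    filter_upwards [ht.eventually_lt_const hε] with n hn x hx
    rw [dist_comm, dist_eq_norm]
    exact (hest n x hx).trans_lt hn

/-- Holomorphic maps on open subsets of finite dimensional spaces are smooth. -/
theorem contDiffOn_of_differentiableOn [FiniteDimensional ℂ E] {U : Set E} (hU : IsOpen U) (n : ℕ) :
    ∀ {f : E → F}, DifferentiableOn ℂ f U → ContDiffOn ℂ n f U := by
  induction n with
  | zero => exact fun hf => contDiffOn_zero.mpr hf.continuousOn
  | succ n ih =>
    intro f hf
    push_cast
    rw [contDiffOn_succ_iff_fderiv_of_isOpen hU]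
    refine ⟨hf, fun h => by simp at h, contDiffOn_clm_apply.mpr fun e => ?_⟩
    exact ih (differentiableOn_fderiv_apply hU hf e)

theorem contDiffAt_of_differentiableOn [FiniteDimensional ℂ E] {U : Set E} (hU : IsOpen U) (n : ℕ)
    {f : E → F} (hf : DifferentiableOn ℂ f U) {x : E} (hx : x ∈ U) : ContDiffAt ℂ n f x :=
  (contDiffOn_of_differentiableOn hU n hf).contDiffAt (hU.mem_nhds hx)

end Cauchy

end SeveralComplexVariables

namespace SeveralComplexVariables

open Metric Set Filter Topology

/-! ### Mixed derivatives and second differences -/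

section SecondDifference

variable {E₁ E₂ F : Type*} [NormedAddCommGroup E₁] [NormedSpace ℂ E₁]
  [NormedAddCommGroup E₂] [NormedSpace ℂ E₂] [NormedAddCommGroup F] [NormedSpace ℂ F]

/-- The mixed derivative `D₁ D₂ f (p) (h, k)` of a function of two vector variables. -/
noncomputable def mixedDeriv (f : E₁ × E₂ → F) (p : E₁ × E₂) (h : E₁) (k : E₂) : F :=
  fderiv ℂ (fun q => fderiv ℂ f q (0, k)) p (h, 0)

theorem mixedDeriv_eq {f : E₁ × E₂ → F} {p : E₁ × E₂} (hf : ContDiffAt ℂ 2 f p) (h : E₁)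
    (k : E₂) : mixedDeriv f p h k = fderiv ℂ (fderiv ℂ f) p (h, 0) (0, k) := by
  have hd : DifferentiableAt ℂ (fderiv ℂ f) p :=
    (hf.fderiv_right (m := 1) (by norm_num)).differentiableAt one_ne_zero
  rw [mixedDeriv, fderiv_clm_apply hd (differentiableAt_const _)]
  simp

theorem mixedDeriv_add {f g : E₁ × E₂ → F} {p : E₁ × E₂} (hf : ContDiffAt ℂ 2 f p)
    (hg : ContDiffAt ℂ 2 g p) (h : E₁) (k : E₂) :
    mixedDeriv (fun q => f q + g q) p h k = mixedDeriv f p h k + mixedDeriv g p h k := by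
  have h1 : ∀ {φ : E₁ × E₂ → F}, ContDiffAt ℂ 2 φ p →
      DifferentiableAt ℂ (fun q => fderiv ℂ φ q (0, k)) p := fun hφ =>
    ((hφ.fderiv_right (m := 1) (by norm_num)).differentiableAt one_ne_zero).clm_apply
      (differentiableAt_const _)
  have h2 : (fun q => fderiv ℂ (fun q => f q + g q) q (0, k)) =ᶠ[𝓝 p]
      fun q => fderiv ℂ f q (0, k) + fderiv ℂ g q (0, k) := by
    filter_upwards [hf.eventually (by simp), hg.eventually (by simp)] with q hq1 hq2
    rw [fderiv_fun_add (hq1.differentiableAt two_ne_zero) (hq2.differentiableAt two_ne_zero)]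
    rfl
  rw [mixedDeriv, h2.fderiv_eq, fderiv_fun_add (h1 hf) (h1 hg)]
  rfl

/-- The mixed derivative of a function of the first variable vanishes. -/
theorem mixedDeriv_fst (f : E₁ → F) {p : E₁ × E₂} (hf : ∀ᶠ x in 𝓝 p.1, DifferentiableAt ℂ f x)
    (h : E₁) (k : E₂) : mixedDeriv (fun q : E₁ × E₂ => f q.1) p h k = 0 := by
  have h1 : (fun q : E₁ × E₂ => fderiv ℂ (fun q : E₁ × E₂ => f q.1) q (0, k)) =ᶠ[𝓝 p]
      fun _ => 0 := by
    filter_upwards [continuousAt_fst.eventually hf] with q hq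
    rw [show (fun q : E₁ × E₂ => f q.1) = f ∘ Prod.fst from rfl,
      (hq.hasFDerivAt.comp q hasFDerivAt_fst).fderiv]
    simp
  rw [mixedDeriv, h1.fderiv_eq]
  simp

/-- The mixed derivative of a function of the second variable vanishes. -/
theorem mixedDeriv_snd (f : E₂ → F) {p : E₁ × E₂} (hf : ∀ᶠ x in 𝓝 p.2, DifferentiableAt ℂ f x)
    (hf2 : DifferentiableAt ℂ (fderiv ℂ f) p.2)
    (h : E₁) (k : E₂) : mixedDeriv (fun q : E₁ × E₂ => f q.2) p h k = 0 := by
  have h1 : (fun q : E₁ × E₂ => fderiv ℂ (fun q : E₁ × E₂ => f q.2) q (0, k)) =ᶠ[𝓝 p]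
      fun q => fderiv ℂ f q.2 k := by
    filter_upwards [continuousAt_snd.eventually hf] with q hq
    rw [show (fun q : E₁ × E₂ => f q.2) = f ∘ Prod.snd from rfl,
      (hq.hasFDerivAt.comp q hasFDerivAt_snd).fderiv]
    simp
  have h2 : DifferentiableAt ℂ (fun y => fderiv ℂ f y k) p.2 :=
    hf2.clm_apply (differentiableAt_const _)
  have h3 := h2.hasFDerivAt.comp p hasFDerivAt_snd
  rw [mixedDeriv, h1.fderiv_eq, show (fun q : E₁ × E₂ => fderiv ℂ f q.2 k) =
    (fun y => fderiv ℂ f y k) ∘ Prod.snd from rfl, h3.fderiv]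
  simp

/-- The mixed second difference is approximated by the mixed derivative, uniformly in the two
increments. -/
theorem exists_norm_second_difference_le {f : E₁ × E₂ → F} {p : E₁ × E₂}
    (hf : ContDiffAt ℂ 2 f p) {ε : ℝ} (hε : 0 < ε) :
    ∃ δ > 0, ∀ h k, ‖h‖ < δ → ‖k‖ < δ →
      ‖f (p.1 + h, p.2 + k) - f (p.1 + h, p.2) - f (p.1, p.2 + k) + f p - mixedDeriv f p h k‖ ≤
        ε * ‖h‖ * ‖k‖ := by
  -- Strict differentiability is essential: the derivatives at the two moving points (p.1 + h, p.2 +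
  -- y) and (p.1, p.2 + y) must be compared with an error proportional to ‖h‖ alone. The mean value
  -- inequality in y then supplies the factor ‖k‖.
  have hs := (hf.fderiv_right (m := 1) (by norm_num)).hasStrictFDerivAt one_ne_zero
  set B := fderiv ℂ (fderiv ℂ f) p with hB
  have h1 := (Asymptotics.isLittleO_iff.mp hs.isLittleO hε)
  obtain ⟨δ₁, hδ₁, h1⟩ := Metric.eventually_nhds_iff_ball.mp h1
  obtain ⟨δ₂, hδ₂, h2⟩ := Metric.eventually_nhds_iff_ball.mp (hf.eventually (by simp))
  refine ⟨min δ₁ δ₂, lt_min hδ₁ hδ₂, fun h k hh hk => ?_⟩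
  rw [mixedDeriv_eq hf]
  have hp : ∀ x y, ‖x‖ < min δ₁ δ₂ → ‖y‖ < min δ₁ δ₂ →
      (p.1 + x, p.2 + y) ∈ ball p δ₁ ∧ (p.1 + x, p.2 + y) ∈ ball p δ₂ := by
    intro x y hx hy
    rw [lt_min_iff] at hx hy
    simp only [mem_ball, Prod.dist_eq, dist_self_add_left, max_lt_iff]
    exact ⟨⟨hx.1, hy.1⟩, hx.2, hy.2⟩
  have h00 : ‖(0 : E₁)‖ < min δ₁ δ₂ := by rw [norm_zero]; exact lt_min hδ₁ hδ₂
  have h00' : ‖(0 : E₂)‖ < min δ₁ δ₂ := by rw [norm_zero]; exact lt_min hδ₁ hδ₂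
  let : NormedSpace ℝ E₂ := NormedSpace.restrictScalars ℝ ℂ E₂
  have hderiv : ∀ x, ‖x‖ < min δ₁ δ₂ → ∀ y, ‖y‖ < min δ₁ δ₂ →
      HasFDerivAt (fun y => f (p.1 + x, p.2 + y))
        ((fderiv ℂ f (p.1 + x, p.2 + y)).comp (ContinuousLinearMap.inr ℂ E₁ E₂)) y := by
    intro x hx y hy
    have hd : HasFDerivAt f _ (p.1 + x, p.2 + y) :=
      ((h2 _ (hp x y hx hy).2).differentiableAt two_ne_zero).hasFDerivAt
    refine hd.comp y ?_
    have : HasFDerivAt (fun y : E₂ => ((p.1, p.2) : E₁ × E₂) + (x, y))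
        (ContinuousLinearMap.inr ℂ E₁ E₂) y := by
      refine HasFDerivAt.const_add _ ?_
      exact (hasFDerivAt_const x y).prodMk (hasFDerivAt_id y)
    exact this
  have key := (convex_ball (0 : E₂) (min δ₁ δ₂)).norm_image_sub_le_of_norm_hasFDerivWithin_le'
    (𝕜 := ℂ) (f := fun y => f (p.1 + h, p.2 + y) - f (p.1 + 0, p.2 + y))
    (φ := (B (h, 0)).comp (ContinuousLinearMap.inr ℂ E₁ E₂)) (C := ε * ‖h‖)
    (fun y hy => ((hderiv h hh y (by simpa using hy)).sub
      (hderiv 0 h00 y (by simpa using hy))).hasFDerivWithinAt)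
    (fun y hy => by
      have hy' : ‖y‖ < min δ₁ δ₂ := by simpa using hy
      have h3 := h1 ((p.1 + h, p.2 + y), (p.1 + 0, p.2 + y)) (by
        rw [← ball_prod_same]
        exact ⟨(hp h y hh hy').1, (hp 0 y h00 hy').1⟩)
      simp only [Prod.mk_sub_mk, add_sub_add_left_eq_sub, sub_zero, sub_self] at h3
      have h4 : ‖((h, 0) : E₁ × E₂)‖ = ‖h‖ := by simp [Prod.norm_def]
      rw [h4] at h3
      rw [← ContinuousLinearMap.sub_comp, ← ContinuousLinearMap.sub_comp]
      refine ContinuousLinearMap.opNorm_le_bound _ (by positivity) fun v => ?_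
      have h5 : ‖((0, v) : E₁ × E₂)‖ = ‖v‖ := by simp [Prod.norm_def]
      rw [ContinuousLinearMap.comp_apply, ContinuousLinearMap.inr_apply]
      refine (ContinuousLinearMap.le_opNorm _ _).trans ?_
      rw [h5]
      exact mul_le_mul_of_nonneg_right h3 (norm_nonneg _))
    (x := 0) (y := k) (by simpa using ⟨hδ₁, hδ₂⟩) (by simpa using hk)
  simp only [add_zero, sub_zero, ContinuousLinearMap.comp_apply,
    ContinuousLinearMap.inr_apply, Prod.mk.eta] at key
  refine le_of_eq_of_le ?_ key
  congr 1
  abel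

theorem differentiableOn_mixedDeriv [CompleteSpace F] {f : E₁ × E₂ → F} {U : Set (E₁ × E₂)}
    (hU : IsOpen U) (hf : DifferentiableOn ℂ f U) (h : E₁) (k : E₂) :
    DifferentiableOn ℂ (fun p => mixedDeriv f p h k) U :=
  differentiableOn_fderiv_apply hU (differentiableOn_fderiv_apply hU hf _) _

/-- Symmetry of the second derivative. It is the source of the transpose in the curvature formula,
where conjugating the base point exchanges the two variables of the kernel. -/
theorem mixedDeriv_swap {E : Type*} [NormedAddCommGroup E] [NormedSpace ℂ E] {f : E × E → F}
    {p : E × E} (hf : ContDiffAt ℂ 2 f p.swap) (h k : E) :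
    mixedDeriv (fun q => f q.swap) p h k = mixedDeriv f p.swap k h := by
  have hsw : ∀ q : E × E, HasFDerivAt (Prod.swap : E × E → E × E)
      ((ContinuousLinearMap.snd ℂ E E).prod (ContinuousLinearMap.fst ℂ E E)) q := fun q =>
    hasFDerivAt_snd.prodMk hasFDerivAt_fst
  have h1 : (fun q : E × E => fderiv ℂ (fun q : E × E => f q.swap) q (0, k)) =ᶠ[𝓝 p]
      fun q => fderiv ℂ f q.swap (k, 0) := by
    have h2 := continuous_swap.continuousAt.eventually (hf.eventually (by simp))
    filter_upwards [h2] with q hq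
    have h3 := (hq.differentiableAt two_ne_zero).hasFDerivAt.comp q (hsw q)
    rw [show (fun q : E × E => f q.swap) = f ∘ Prod.swap from rfl, h3.fderiv]
    simp
  have hd : DifferentiableAt ℂ (fderiv ℂ f) p.swap :=
    (hf.fderiv_right (m := 1) (by norm_num)).differentiableAt one_ne_zero
  have h4 : HasFDerivAt (fun q => fderiv ℂ f q (k, 0)) _ p.swap :=
    hd.hasFDerivAt.clm_apply (hasFDerivAt_const (k, (0 : E)) p.swap)
  have h5 := h4.comp p (hsw p)
  rw [mixedDeriv, h1.fderiv_eq, show (fun q : E × E => fderiv ℂ f q.swap (k, 0)) =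
    (fun q => fderiv ℂ f q (k, 0)) ∘ Prod.swap from rfl, h5.fderiv, mixedDeriv_eq hf]
  have hsym : IsSymmSndFDerivAt ℂ f p.swap := hf.isSymmSndFDerivAt (by simp)
  simpa using hsym.eq (0, h) (k, 0)

end SecondDifference

/-! ### The identity theorem along complex lines -/

section Identity

variable {E F : Type*} [NormedAddCommGroup E] [NormedSpace ℂ E]
  [NormedAddCommGroup F] [NormedSpace ℂ F] [CompleteSpace F]

/-- The identity theorem on a complex line. -/
theorem eq_zero_of_frequently_line {s : Set E} (hs : IsOpen s) {f : E → F}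
    (hf : DifferentiableOn ℂ f s) {a b : E}
    (hc : IsPreconnected ((fun ζ : ℂ => a + ζ • b) ⁻¹' s)) (ha : a ∈ s)
    (h0 : ∃ᶠ ζ : ℂ in 𝓝[≠] 0, f (a + ζ • b) = 0) {ζ : ℂ} (hζ : a + ζ • b ∈ s) :
    f (a + ζ • b) = 0 := by
  have hcont : Continuous fun ζ : ℂ => a + ζ • b := by fun_prop
  have hopen : IsOpen ((fun ζ : ℂ => a + ζ • b) ⁻¹' s) := hs.preimage hcont
  have hd : DifferentiableOn ℂ (fun ζ : ℂ => f (a + ζ • b)) ((fun ζ : ℂ => a + ζ • b) ⁻¹' s) :=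
    hf.comp (by fun_prop) fun x hx => hx
  exact (hd.analyticOnNhd hopen).eqOn_zero_of_preconnected_of_frequently_eq_zero
    hc (z₀ := 0) (by simpa using ha) h0 hζ

theorem convex_preimage_line [NormedSpace ℝ E] [IsScalarTower ℝ ℂ E] {s : Set E}
    (hc : Convex ℝ s) (a b : E) : Convex ℝ ((fun ζ : ℂ => a + ζ • b) ⁻¹' s) := by
  intro x hx y hy u v hu hv huv
  have := hc hx hy hu hv huv
  simp only [mem_preimage] at *
  convert this using 1
  have ha' : a = u • a + v • a := by rw [← add_smul, huv, one_smul]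
  rw [smul_add, smul_add, add_smul, smul_assoc, smul_assoc, add_add_add_comm, ← ha']

end Identity

end SeveralComplexVariables

/-! ### Holomorphic averages and holomorphic logarithms -/

namespace SeveralComplexVariables

open Metric Set Filter Topology

/-- Averages of a holomorphic map along a continuous family of linear maps are holomorphic. -/
theorem differentiableOn_integral_comp {E F : Type*} [NormedAddCommGroup E] [NormedSpace ℂ E]
    [FiniteDimensional ℂ E] [NormedAddCommGroup F] [NormedSpace ℂ F] [CompleteSpace F]
    {f : E → F} {U : Set E} (hU : IsOpen U) (hf : DifferentiableOn ℂ f U) {T : ℝ → E →L[ℂ] E}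
    (hT : Continuous T) (hTU : ∀ s ∈ Icc (0 : ℝ) 1, MapsTo (T s) U U) :
    DifferentiableOn ℂ (fun x => ∫ s in (0 : ℝ)..1, f (T s x)) U := by
  intro x₀ hx₀
  refine DifferentiableAt.differentiableWithinAt ?_
  have : ProperSpace E := FiniteDimensional.proper ℂ E
  obtain ⟨r, hr, hrU⟩ := nhds_basis_closedBall.mem_iff.mp (hU.mem_nhds hx₀)
  have hcT : Continuous fun q : E × ℝ => T q.2 q.1 := by fun_prop
  have hmaps : MapsTo (fun q : E × ℝ => T q.2 q.1) (closedBall x₀ r ×ˢ Icc (0 : ℝ) 1) U :=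
    fun q hq => hTU q.2 hq.2 (hrU hq.1)
  have hcf : ContinuousOn (fun q : E × ℝ => f (T q.2 q.1)) (closedBall x₀ r ×ˢ Icc (0 : ℝ) 1) :=
    hf.continuousOn.comp hcT.continuousOn hmaps
  have hcf' : ContinuousOn (fun q : E × ℝ => (fderiv ℂ f (T q.2 q.1)).comp (T q.2))
      (closedBall x₀ r ×ˢ Icc (0 : ℝ) 1) :=
    ((continuousOn_fderiv hU hf).comp hcT.continuousOn hmaps).clm_comp (by fun_prop)
  -- Compactness provides the constant dominating the derivatives, as required for differentiation
  -- under the integral.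
  obtain ⟨C, hC⟩ := ((isCompact_closedBall x₀ r).prod isCompact_Icc).exists_bound_of_continuousOn
    hcf'
  have hI : uIoc (0 : ℝ) 1 ⊆ Icc 0 1 := by
    rw [uIoc_of_le zero_le_one]; exact Ioc_subset_Icc_self
  have hslice : ∀ x ∈ closedBall x₀ r, ContinuousOn (fun s => f (T s x)) (Icc (0 : ℝ) 1) :=
    fun x hx => hcf.comp (f := fun s : ℝ => (x, s)) (by fun_prop) fun s hs => ⟨hx, hs⟩
  refine (intervalIntegral.hasFDerivAt_integral_of_dominated_of_fderiv_le
    (F := fun x s => f (T s x)) (F' := fun x s => (fderiv ℂ f (T s x)).comp (T s))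
    (s := closedBall x₀ r) (bound := fun _ => C)
    (closedBall_mem_nhds x₀ hr) ?_ ?_ ?_ ?_ ?_ ?_).differentiableAt
  · filter_upwards [closedBall_mem_nhds x₀ hr] with x hx
    exact ((hslice x hx).mono hI).aestronglyMeasurable measurableSet_uIoc
  · refine ContinuousOn.intervalIntegrable ?_
    rw [uIcc_of_le zero_le_one]
    exact hslice x₀ (mem_closedBall_self hr.le)
  · have h1 : ContinuousOn (fun s => (fderiv ℂ f (T s x₀)).comp (T s)) (Icc (0 : ℝ) 1) :=
      hcf'.comp (f := fun s : ℝ => (x₀, s)) (by fun_prop)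
        fun s hs => ⟨mem_closedBall_self hr.le, hs⟩
    exact (h1.mono hI).aestronglyMeasurable measurableSet_uIoc
  · exact Eventually.of_forall fun s hs x hx => hC (x, s) ⟨hx, hI hs⟩
  · exact intervalIntegrable_const
  · refine Eventually.of_forall fun s hs x hx => ?_
    have h1 : DifferentiableAt ℂ f (T s x) :=
      hf.differentiableAt (hU.mem_nhds (hTU s (hI hs) (hrU hx)))
    exact h1.hasFDerivAt.comp x (T s).hasFDerivAt

/-- A nowhere vanishing holomorphic function on a convex open set has a holomorphic logarithm. -/
theorem exists_differentiableOn_log {E : Type*} [NormedAddCommGroup E] [NormedSpace ℂ E]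
    [NormedSpace ℝ E] {U : Set E} (hU : IsOpen U) (hc : Convex ℝ U) {f : E → ℂ}
    (hf : DifferentiableOn ℂ f U) (h0 : ∀ x ∈ U, f x ≠ 0) {a : E} (ha : a ∈ U) {c : ℂ}
    (hca : Complex.exp c = f a) :
    ∃ g : E → ℂ, DifferentiableOn ℂ g U ∧ (∀ x ∈ U, Complex.exp (g x) = f x) ∧ g a = c := by
  have hsc : IsSimplyConnected U := by
    have := hc.contractibleSpace ⟨a, ha⟩
    exact SimplyConnectedSpace.ofContractible U
  have := hc.locallyPathConnectedSpace
  obtain ⟨g₀, hg₀c, hg₀⟩ := Complex.exists_continuousOn_eqOn_exp_comp hsc hU hf.continuousOn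
    (by rintro ⟨x, hx, h⟩; exact h0 x hx h)
  have hg₀' : ∀ x ∈ U, Complex.exp (g₀ x) = f x := fun x hx => hg₀ hx
  refine ⟨fun x => g₀ x - g₀ a + c, ?_, fun x hx => ?_, by ring⟩
  · intro x hx
    refine DifferentiableAt.differentiableWithinAt ?_
    have hfx : DifferentiableAt ℂ f x := hf.differentiableAt (hU.mem_nhds hx)
    -- Continuity keeps g₀ y - g₀ x inside the strip of the principal branch, so locally the
    -- topological logarithm is a principal logarithm up to a constant, hence holomorphic.
    have h1 : ∀ᶠ y in 𝓝 x, g₀ y = Complex.log (f y * (f x)⁻¹) + g₀ x := by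
      have h2 := (hg₀c.continuousAt (hU.mem_nhds hx)).sub (continuousAt_const (y := g₀ x))
      have h3 : ∀ᶠ y in 𝓝 x, ‖g₀ y - g₀ x‖ < Real.pi := by
        have := h2.norm.tendsto
        simp only [Pi.sub_apply, sub_self, norm_zero] at this
        exact this.eventually_lt_const Real.pi_pos
      filter_upwards [h3, hU.mem_nhds hx] with y hy hyU
      have h4 := abs_lt.mp ((Complex.abs_im_le_norm _).trans_lt hy)
      rw [← hg₀' y hyU, ← hg₀' x hx, ← div_eq_mul_inv, ← Complex.exp_sub, Complex.log_exp h4.1 h4.2.le]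
      ring
    have h5 : DifferentiableAt ℂ (fun y => Complex.log (f y * (f x)⁻¹) + g₀ x) x := by
      refine DifferentiableAt.add_const _ (DifferentiableAt.clog (hfx.mul_const (f x)⁻¹) ?_)
      rw [mul_inv_cancel₀ (h0 x hx)]
      exact Complex.one_mem_slitPlane
    exact ((h5.congr_of_eventuallyEq h1).sub_const _).add_const _
  · rw [Complex.exp_add, Complex.exp_sub, hg₀' x hx, hg₀' a ha, hca,
      div_mul_cancel₀ _ (h0 a ha)]

end SeveralComplexVariables

/-! ### Conjugation on ℂᵐ and uniqueness of polarizations -/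

namespace CowenDouglas

open Metric Set Filter Topology SeveralComplexVariables

variable {m : ℕ}

@[simp] theorem conjVec_apply (w : Cn m) (i : Fin m) : conjVec w i = conj (w i) := rfl

@[simp] theorem conjVec_conjVec (w : Cn m) : conjVec (conjVec w) = w := by ext i; simp

theorem conjVec_add (v w : Cn m) : conjVec (v + w) = conjVec v + conjVec w := by ext i; simp

theorem conjVec_smul (c : ℂ) (w : Cn m) : conjVec (c • w) = conj c • conjVec w := by ext i; simp

@[simp] theorem norm_conjVec (w : Cn m) : ‖conjVec w‖ = ‖w‖ := by
  simp [EuclideanSpace.norm_eq]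

@[simp] theorem conjVec_zero : conjVec (0 : Cn m) = 0 := by ext i; simp

/-- Coordinatewise conjugation as a real linear map. -/
noncomputable def conjVecCLM (m : ℕ) : Cn m →L[ℝ] Cn m :=
  LinearMap.mkContinuous
    { toFun := conjVec
      map_add' := conjVec_add
      map_smul' := fun c w => by ext i; simp } 1 fun w => by simp

@[simp] theorem conjVecCLM_apply (w : Cn m) : conjVecCLM m w = conjVec w := rfl

theorem continuous_conjVec : Continuous (conjVec : Cn m → Cn m) := (conjVecCLM m).continuous

theorem conjVec_mem_ball {w : Cn m} {r : ℝ} : conjVec w ∈ ball (0 : Cn m) r ↔ w ∈ ball 0 r := by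
  simp

theorem conjVec_preimage_ball (r : ℝ) : conjVec ⁻¹' ball (0 : Cn m) r = ball 0 r := by
  ext w; simp

/-- `w ↦ conj (f (conj w))` is holomorphic where `f` is. -/
theorem differentiableAt_conj_comp_conjVec {f : Cn m → ℂ} {w : Cn m}
    (hf : DifferentiableAt ℂ f (conjVec w)) :
    DifferentiableAt ℂ (fun v => conj (f (conjVec v))) w := by
  -- The two conjugations cancel, so the real derivative obtained from the chain rule is complex
  -- linear; D is that complex linear map.
  set D : Cn m →L[ℂ] ℂ := LinearMap.toContinuousLinearMap
    { toFun := fun k => conj (fderiv ℂ f (conjVec w) (conjVec k))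
      map_add' := fun x y => by simp [conjVec_add]
      map_smul' := fun c x => by simp [conjVec_smul] } with hD
  have h1 : HasFDerivAt (fun v => conj (f (conjVec v)))
      ((Complex.conjCLE : ℂ →L[ℝ] ℂ).comp
        (((fderiv ℂ f (conjVec w)).restrictScalars ℝ).comp (conjVecCLM m))) w := by
    have h2 : HasFDerivAt f ((fderiv ℂ f (conjVec w)).restrictScalars ℝ) (conjVecCLM m w) :=
      hf.hasFDerivAt.restrictScalars ℝ
    exact Complex.conjCLE.hasFDerivAt.comp w (h2.comp w (conjVecCLM m).hasFDerivAt)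
  exact (hasFDerivAt_of_restrictScalars ℝ (f' := D) h1 (by ext k; simp [hD])).differentiableAt

/-- Every `(z, u)` lies on a complex line `ζ ↦ (a + ζ b, conj a + ζ conj b)`. -/
theorem exists_line (z u : Cn m) : ∃ a b : Cn m, a + Complex.I • b = z ∧
    conjVec a + Complex.I • conjVec b = u ∧ a = (1 / 2 : ℝ) • z + (1 / 2 : ℝ) • conjVec u := by
  -- The target is reached at ζ = I. Taking the midpoint of z and conj u for a keeps a in any convex
  -- set containing both.
  refine ⟨(1 / 2 : ℝ) • z + (1 / 2 : ℝ) • conjVec u,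
    (1 / (2 * Complex.I) : ℂ) • (z - conjVec u), ?_, ?_, rfl⟩
  · ext i
    simp only [PiLp.add_apply, PiLp.smul_apply, PiLp.sub_apply, smul_eq_mul, conjVec_apply,
      Complex.real_smul]
    push_cast
    field_simp
    ring
  · ext i
    simp only [PiLp.add_apply, PiLp.smul_apply, PiLp.sub_apply, smul_eq_mul, conjVec_apply,
      Complex.real_smul, map_mul, map_add, map_sub, map_div₀, map_one, map_ofNat, Complex.conj_I,
      Complex.conj_conj, Complex.conj_ofReal]
    push_cast
    have := Complex.I_ne_zero
    field_simp
    ring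

theorem isPreconnected_preimage_line_ball_prod {r : ℝ} (a b : Cn m × Cn m) :
    IsPreconnected ((fun ζ : ℂ => a + ζ • b) ⁻¹' (ball (0 : Cn m) r ×ˢ ball (0 : Cn m) r)) :=
  ((convex_preimage_line (convex_ball (0 : Cn m) r) a.1 b.1).inter
    (convex_preimage_line (convex_ball (0 : Cn m) r) a.2 b.2)).isPreconnected

theorem tendsto_ofReal_nhdsNE_zero : Tendsto (fun x : ℝ => (x : ℂ)) (𝓝[≠] 0) (𝓝[≠] 0) := by
  refine tendsto_nhdsWithin_of_tendsto_nhds_of_eventually_within _ ?_ ?_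
  · have := Complex.continuous_ofReal.tendsto 0
    rw [Complex.ofReal_zero] at this
    exact this.mono_left nhdsWithin_le_nhds
  · filter_upwards [self_mem_nhdsWithin] with x hx
    simpa using hx

/-- A holomorphic function of two variables vanishing on the anti-diagonal `u = conj z`
vanishes. -/
theorem eq_zero_of_antidiagonal {r : ℝ} {f : Cn m × Cn m → ℂ}
    (hf : DifferentiableOn ℂ f (ball 0 r ×ˢ ball 0 r))
    (h0 : ∀ v ∈ ball (0 : Cn m) r, f (v, conjVec v) = 0) {p : Cn m × Cn m}
    (hp : p ∈ ball (0 : Cn m) r ×ˢ ball (0 : Cn m) r) : f p = 0 := by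
  obtain ⟨z, u⟩ := p
  have hu : conjVec u ∈ ball (0 : Cn m) r := conjVec_mem_ball.mpr hp.2
  obtain ⟨a, b, hzab, huab, ha⟩ := exists_line z u
  have hconv : Convex ℝ (ball (0 : Cn m) r) := convex_ball _ _
  have haz : a ∈ ball (0 : Cn m) r := by
    rw [ha]
    exact hconv hp.1 hu (by norm_num) (by norm_num) (by norm_num)
  have hab : (a, conjVec a) + Complex.I • (b, conjVec b) = (z, u) := by
    rw [Prod.smul_mk, Prod.mk_add_mk, hzab, huab]
  -- For real ζ the line runs inside the anti-diagonal, so f has zeros accumulating at ζ = 0.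
  have hfreq : ∃ᶠ ζ : ℂ in 𝓝[≠] 0, f ((a, conjVec a) + ζ • (b, conjVec b)) = 0 := by
    refine tendsto_ofReal_nhdsNE_zero.frequently (Eventually.frequently ?_)
    have hcont : Continuous fun x : ℝ => a + (x : ℂ) • b := by fun_prop
    have h1 : ∀ᶠ x : ℝ in 𝓝 0, a + (x : ℂ) • b ∈ ball (0 : Cn m) r := by
      refine hcont.continuousAt.eventually (isOpen_ball.mem_nhds ?_)
      simpa using haz
    filter_upwards [h1.filter_mono nhdsWithin_le_nhds] with x hx
    have := h0 _ hx
    rw [conjVec_add, conjVec_smul, Complex.conj_ofReal] at this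
    rwa [Prod.smul_mk, Prod.mk_add_mk]
  have hline : f ((a, conjVec a) + Complex.I • (b, conjVec b)) = 0 := by
    refine eq_zero_of_frequently_line (isOpen_ball.prod isOpen_ball) hf
      (isPreconnected_preimage_line_ball_prod _ _) ?_ hfreq ?_
    · exact ⟨haz, conjVec_mem_ball.mpr haz⟩
    · rw [hab]
      exact hp
  rwa [hab] at hline

/-- A holomorphic function on `B × B` vanishing near the center vanishes. -/
theorem eq_zero_of_eventually_zero {r : ℝ} {f : Cn m × Cn m → ℂ}
    (hf : DifferentiableOn ℂ f (ball 0 r ×ˢ ball 0 r)) (h0 : ∀ᶠ p in 𝓝 0, f p = 0)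
    {p : Cn m × Cn m} (hp : p ∈ ball (0 : Cn m) r ×ˢ ball (0 : Cn m) r) : f p = 0 := by
  have hr : 0 < r := pos_of_mem_ball hp.1
  have ht : Tendsto (fun ζ : ℂ => (0 : Cn m × Cn m) + ζ • p) (𝓝 0) (𝓝 0) := by
    have : Continuous fun ζ : ℂ => (0 : Cn m × Cn m) + ζ • p := by fun_prop
    simpa using this.tendsto 0
  have hline : f (0 + (1 : ℂ) • p) = 0 := by
    refine eq_zero_of_frequently_line (isOpen_ball.prod isOpen_ball) hf
      (isPreconnected_preimage_line_ball_prod _ _) ?_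
      ((ht.eventually h0).filter_mono nhdsWithin_le_nhds).frequently ?_
    · exact ⟨mem_ball_self hr, mem_ball_self hr⟩
    · rwa [zero_add, one_smul]
  rwa [zero_add, one_smul] at hline

/-! ### The complex Hessian of a function given by its polarization -/

theorem hasFDerivAt_comp_diag {Φ : Cn m × Cn m → ℂ} {v : Cn m}
    (hΦ : DifferentiableAt ℂ Φ (v, conjVec v)) :
    HasFDerivAt (fun v => Φ (v, conjVec v))
      (((fderiv ℂ Φ (v, conjVec v)).restrictScalars ℝ).comp
        ((ContinuousLinearMap.id ℝ (Cn m)).prod (conjVecCLM m))) v := by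
  have h1 : HasFDerivAt Φ ((fderiv ℂ Φ (v, conjVec v)).restrictScalars ℝ)
      ((fun v => (v, conjVecCLM m v)) v) := hΦ.hasFDerivAt.restrictScalars ℝ
  exact h1.comp v ((hasFDerivAt_id v).prodMk (conjVecCLM m).hasFDerivAt)

theorem conjVec_single_one (j : Fin m) :
    conjVec (EuclideanSpace.single j (1 : ℂ)) = EuclideanSpace.single j 1 := by
  ext i; by_cases h : i = j <;> simp [h]

theorem single_I (j : Fin m) : EuclideanSpace.single j Complex.I =
    Complex.I • EuclideanSpace.single j (1 : ℂ) := by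
  ext i; by_cases h : i = j <;> simp [h]

theorem conjVec_single_I (j : Fin m) : conjVec (EuclideanSpace.single j Complex.I) =
    -(Complex.I • EuclideanSpace.single j (1 : ℂ)) := by
  rw [single_I, conjVec_smul, conjVec_single_one, Complex.conj_I, neg_smul]

/-- Moving v along e and along I • e moves the point of the anti-diagonal by (e, e) and (I • e, -I •
e). The Wirtinger combination cancels the part in the first variable. -/
theorem dWbar_comp_diag {Φ : Cn m × Cn m → ℂ} {v : Cn m}
    (hΦ : DifferentiableAt ℂ Φ (v, conjVec v)) (j : Fin m) :
    dWbar j (fun v => Φ (v, conjVec v)) v =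
      fderiv ℂ Φ (v, conjVec v) (0, EuclideanSpace.single j 1) := by
  set e : Cn m := EuclideanSpace.single j (1 : ℂ)
  set L := fderiv ℂ Φ (v, conjVec v)
  have h1 : L (e, e) = L (e, 0) + L (0, e) := by rw [← map_add]; simp
  have h2 : L (Complex.I • e, -(Complex.I • e)) = Complex.I * L (e, 0) - Complex.I * L (0, e) := by
    rw [← smul_eq_mul, ← smul_eq_mul, ← map_smul, ← map_smul, ← map_sub]; simp
  rw [dWbar, (hasFDerivAt_comp_diag hΦ).fderiv]
  simp only [ContinuousLinearMap.comp_apply, ContinuousLinearMap.prod_apply,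
    ContinuousLinearMap.id_apply, conjVecCLM_apply, ContinuousLinearMap.coe_restrictScalars',
    conjVec_single_one, conjVec_single_I]
  rw [single_I]
  rw [h1, h2]
  linear_combination (1 / 2 : ℂ) * (L (e, 0) - L (0, e)) * Complex.I_mul_I

theorem dW_comp_diag {Φ : Cn m × Cn m → ℂ} {v : Cn m}
    (hΦ : DifferentiableAt ℂ Φ (v, conjVec v)) (i : Fin m) :
    dW i (fun v => Φ (v, conjVec v)) v =
      fderiv ℂ Φ (v, conjVec v) (EuclideanSpace.single i 1, 0) := by
  set e : Cn m := EuclideanSpace.single i (1 : ℂ)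
  set L := fderiv ℂ Φ (v, conjVec v)
  have h1 : L (e, e) = L (e, 0) + L (0, e) := by rw [← map_add]; simp
  have h2 : L (Complex.I • e, -(Complex.I • e)) = Complex.I * L (e, 0) - Complex.I * L (0, e) := by
    rw [← smul_eq_mul, ← smul_eq_mul, ← map_smul, ← map_smul, ← map_sub]; simp
  rw [dW, (hasFDerivAt_comp_diag hΦ).fderiv]
  simp only [ContinuousLinearMap.comp_apply, ContinuousLinearMap.prod_apply,
    ContinuousLinearMap.id_apply, conjVecCLM_apply, ContinuousLinearMap.coe_restrictScalars',
    conjVec_single_one, conjVec_single_I]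
  rw [single_I]
  rw [h1, h2]
  linear_combination (-1 / 2 : ℂ) * (L (e, 0) - L (0, e)) * Complex.I_mul_I

/-- If `log g` is the restriction to the anti-diagonal of a holomorphic function `Φ`, its complex
Hessian consists of the mixed derivatives of `Φ`. -/
theorem hessLog_eq_mixedDeriv {g : Cn m → ℝ} {Φ : Cn m × Cn m → ℂ} {U : Set (Cn m × Cn m)}
    {w : Cn m} (hU : IsOpen U) (hwU : (w, conjVec w) ∈ U) (hΦ : DifferentiableOn ℂ Φ U)
    (hg : ∀ᶠ v in 𝓝 w, ((Real.log (g v) : ℝ) : ℂ) = Φ (v, conjVec v)) (i j : Fin m) :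
    hessLog g w i j = mixedDeriv Φ (w, conjVec w) (EuclideanSpace.single i 1)
      (EuclideanSpace.single j 1) := by
  have hc : Continuous fun v : Cn m => (v, conjVec v) := continuous_id.prodMk continuous_conjVec
  have hev : ∀ᶠ v in 𝓝 w, (v, conjVec v) ∈ U := hc.continuousAt.eventually (hU.mem_nhds hwU)
  have h1 : dWbar j (fun v => ((Real.log (g v) : ℝ) : ℂ)) =ᶠ[𝓝 w]
      fun v => (fun q => fderiv ℂ Φ q (0, EuclideanSpace.single j 1)) (v, conjVec v) := by
    filter_upwards [hg.eventually_nhds, hev] with v hv hvU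
    rw [← dWbar_comp_diag (hΦ.differentiableAt (hU.mem_nhds hvU)), dWbar, dWbar,
      Filter.EventuallyEq.fderiv_eq hv]
  have h2 := (differentiableOn_fderiv_apply hU hΦ
    ((0 : Cn m), EuclideanSpace.single j (1 : ℂ))).differentiableAt (hU.mem_nhds hwU)
  rw [hessLog, Matrix.of_apply, dW, h1.fderiv_eq, ← dW, dW_comp_diag h2]
  rfl

end CowenDouglas

/-! ### Positive semidefinite kernels and Gram representations -/

namespace Matrix

open Filter Topology

variable {X : Type} {A : Matrix X X ℂ}

theorem PosSemidef.sum_nonneg (hA : A.PosSemidef) {ι : Type} [Fintype ι] (x : ι → X) (c : ι → ℂ) :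
    0 ≤ ∑ a, ∑ b, conj (c a) * A (x a) (x b) * c b := by
  have h := (hA.submatrix x).dotProduct_mulVec_nonneg c
  simp only [dotProduct, mulVec, submatrix_apply, Finset.mul_sum, Pi.star_apply] at h
  simpa only [mul_assoc, starRingEnd_apply] using h

/-- Positive semidefiniteness over `ℂ` may be tested on finite families; hermitianity is
automatic. -/
theorem PosSemidef.of_sum_nonneg (h : ∀ (ι : Type) [Fintype ι] (x : ι → X) (c : ι → ℂ),
    0 ≤ ∑ a, ∑ b, conj (c a) * A (x a) (x b) * c b) : A.PosSemidef := by
  refine ⟨?_, fun x => ?_⟩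
  · ext i j
    -- Polarization: one-point families make the diagonal real, and the weights (1, 1) and (1, I)
    -- then make A i j + A j i and I * (A i j - A j i) real.
    have hi := (Complex.le_def.mp (h Unit (fun _ => i) fun _ => 1)).2
    have hj := (Complex.le_def.mp (h Unit (fun _ => j) fun _ => 1)).2
    have h1 := (Complex.le_def.mp (h (Fin 2) ![i, j] ![1, 1])).2
    have h2 := (Complex.le_def.mp (h (Fin 2) ![i, j] ![1, Complex.I])).2
    simp [Fin.sum_univ_two] at hi hj h1 h2
    rw [conjTranspose_apply]
    refine Complex.ext ?_ ?_ <;> simp <;> linarith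
  · have h1 := h x.support Subtype.val fun a => x a
    refine h1.trans_eq ?_
    simp only [Finsupp.sum]
    rw [← Finset.sum_coe_sort x.support]
    refine Finset.sum_congr rfl fun a _ => ?_
    rw [← Finset.sum_coe_sort x.support]
    rfl

theorem PosSemidef.of_tendsto {ι : Type*} {l : Filter ι} [l.NeBot] {B : ι → Matrix X X ℂ}
    (hB : ∀ᶠ n in l, (B n).PosSemidef) (h : ∀ x y, Tendsto (fun n => B n x y) l (𝓝 (A x y))) :
    A.PosSemidef := by
  refine PosSemidef.of_sum_nonneg fun κ _ x c => ?_
  have ht : Tendsto (fun n => ∑ a, ∑ b, conj (c a) * B n (x a) (x b) * c b) l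
      (𝓝 (∑ a, ∑ b, conj (c a) * A (x a) (x b) * c b)) :=
    tendsto_finsetSum _ fun a _ => tendsto_finsetSum _ fun b _ =>
      ((h _ _).const_mul _).mul_const _
  exact ge_of_tendsto ht (hB.mono fun n hn => hn.sum_nonneg x c)

/-- Kernels of Gram form are positive semidefinite. -/
theorem PosSemidef.of_inner {H : Type*} [NormedAddCommGroup H] [InnerProductSpace ℂ H]
    (V : X → H) (hA : ∀ x y, A x y = inner ℂ (V x) (V y)) : A.PosSemidef := by
  refine PosSemidef.of_sum_nonneg fun ι _ x c => ?_
  have h : 0 ≤ inner ℂ (∑ a, c a • V (x a)) (∑ a, c a • V (x a)) := by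
    rw [inner_self_eq_norm_sq_to_K, ← RCLike.ofReal_pow]
    exact RCLike.ofReal_nonneg.mpr (sq_nonneg _)
  refine h.trans_eq ?_
  simp only [sum_inner, inner_sum, inner_smul_left, inner_smul_right, hA, Finset.mul_sum]
  rw [Finset.sum_comm]
  refine Finset.sum_congr rfl fun a _ => Finset.sum_congr rfl fun b _ => ?_
  ring

theorem PosSemidef.of_rank_one (f : X → ℂ) : (of fun x y => f x * conj (f y)).PosSemidef :=
  PosSemidef.of_inner (H := ℂ) (fun x => conj (f x)) fun x y => by simp [mul_comm]

theorem PosSemidef.hadamard_pow (hA : A.PosSemidef) (n : ℕ) :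
    (of fun x y => A x y ^ n).PosSemidef := by
  induction n with
  | zero => simpa using PosSemidef.of_rank_one (X := X) fun _ => 1
  | succ n ih =>
    have h := ih.hadamard hA
    exact h

/-- The entrywise exponential of a positive semidefinite kernel is positive semidefinite. -/
theorem PosSemidef.hadamard_exp (hA : A.PosSemidef) :
    (of fun x y => Complex.exp (A x y)).PosSemidef := by
  refine PosSemidef.of_tendsto (l := atTop)
    (B := fun n : ℕ => ∑ k ∈ Finset.range n, ((k.factorial : ℂ)⁻¹) • of fun x y => A x y ^ k)
    (Eventually.of_forall fun n => posSemidef_sum _ fun k _ => (hA.hadamard_pow k).smul ?_)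
    fun x y => ?_
  · exact inv_nonneg.mpr (Nat.cast_nonneg _)
  · have h := (NormedSpace.expSeries_div_hasSum_exp (A x y)).tendsto_sum_nat
    rw [← Complex.exp_eq_exp_ℂ] at h
    simp only [sum_apply, smul_apply, of_apply, smul_eq_mul]
    simpa only [div_eq_inv_mul] using h

/-- Moore's theorem: a positive semidefinite kernel is the Gram kernel of a family of vectors of a
Hilbert space. -/
theorem PosSemidef.exists_inner (hA : A.PosSemidef) :
    ∃ (H : Type) (_ : NormedAddCommGroup H) (_ : InnerProductSpace ℂ H) (_ : CompleteSpace H)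
      (k : X → H), ∀ x y, inner ℂ (k x) (k y) = A x y := by
  have hH : ∀ z w, conj (A w z) = A z w := fun z w => hA.1.apply z w
  let K : Matrix X X (ℂ →L[ℂ] ℂ) := of fun z w => A z w • ContinuousLinearMap.id ℂ ℂ
  have hK : Fact K.PosSemidef := by
    have hT := (RKHS.posSemidef_tfae (K := K)).out 2 0
    refine ⟨hT.mp ⟨?_, fun vv => ?_⟩⟩
    · ext z w
      simp [K, conjTranspose_apply, ContinuousLinearMap.star_eq_adjoint,
        hH, show ContinuousLinearMap.adjoint (ContinuousLinearMap.id ℂ ℂ) =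
          ContinuousLinearMap.id ℂ ℂ from ContinuousLinearMap.adjoint_id]
    · have h := (Complex.le_def.mp (hA.2 vv)).1
      refine le_of_le_of_eq h ?_
      simp only [Finsupp.sum]
      congr 1
      refine Finset.sum_congr rfl fun x _ => Finset.sum_congr rfl fun y _ => ?_
      simp [K, hH]
      ring
  refine ⟨RKHS.OfKernel K, inferInstance, inferInstance, inferInstance,
    fun x => RKHS.kerFun (RKHS.OfKernel K) x 1, fun x y => ?_⟩
  rw [RKHS.kerFun_inner, RKHS.kerFun_apply, RKHS.OfKernel.kernel_ofKernel]
  simp [K]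

end Matrix

/-- A map into a Hilbert space with continuous Gram kernel is continuous. -/
theorem continuous_of_continuous_inner {S H : Type*} [TopologicalSpace S] [NormedAddCommGroup H]
    [InnerProductSpace ℂ H] {k : S → H}
    (hk : Continuous fun p : S × S => inner ℂ (k p.1) (k p.2)) : Continuous k := by
  rw [continuous_iff_continuousAt]
  intro s
  rw [ContinuousAt, tendsto_iff_norm_sub_tendsto_zero]
  have h1 : ∀ t, ‖k t - k s‖ = √(inner ℂ (k t) (k t) - inner ℂ (k t) (k s) - inner ℂ (k s) (k t) +
      inner ℂ (k s) (k s)).re := by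
    intro t
    rw [norm_eq_sqrt_re_inner (𝕜 := ℂ), inner_sub_sub_self]
    rfl
  simp only [h1]
  have hc : Continuous fun t => √(inner ℂ (k t) (k t) - inner ℂ (k t) (k s) - inner ℂ (k s) (k t) +
      inner ℂ (k s) (k s)).re := by
    have h2 : Continuous fun t => inner ℂ (k t) (k t) := hk.comp (by fun_prop : Continuous fun t => (t, t))
    have h3 : Continuous fun t => inner ℂ (k t) (k s) := hk.comp (by fun_prop : Continuous fun t => (t, s))
    have h4 : Continuous fun t => inner ℂ (k s) (k t) := hk.comp (by fun_prop : Continuous fun t => (s, t))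
    exact (Complex.continuous_re.comp (((h2.sub h3).sub h4).add continuous_const)).sqrt
  simpa using hc.tendsto s

/-- The inner product of two integrals as an iterated integral. -/
theorem inner_intervalIntegral_intervalIntegral {H : Type*} [NormedAddCommGroup H]
    [InnerProductSpace ℂ H] [CompleteSpace H] {f g : ℝ → H} (hf : Continuous f)
    (hg : Continuous g) (a b : ℝ) :
    inner ℂ (∫ s in a..b, f s) (∫ t in a..b, g t) =
      ∫ t in a..b, ∫ s in a..b, inner ℂ (f s) (g t) := by
  have h1 : ∀ (v : H) (φ : ℝ → H), Continuous φ →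
      inner ℂ v (∫ t in a..b, φ t) = ∫ t in a..b, inner ℂ v (φ t) := fun v φ hφ =>
    ((innerSL ℂ v).intervalIntegral_comp_comm (hφ.intervalIntegrable a b)).symm
  rw [h1 _ _ hg]
  congr 1
  ext t
  rw [← inner_conj_symm, h1 _ _ hf]
  have h2 : conj (∫ s in a..b, inner ℂ (g t) (f s)) = ∫ s in a..b, conj (inner ℂ (g t) (f s)) := by
    simp only [intervalIntegral, map_sub, integral_conj]
  rw [h2]
  simp only [inner_conj_symm]

/-! ### Second difference quotients -/

namespace SeveralComplexVariables

open Metric Set Filter Topology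

variable {E₁ E₂ : Type*} [NormedAddCommGroup E₁] [NormedSpace ℂ E₁]
  [NormedAddCommGroup E₂] [NormedSpace ℂ E₂]

theorem mixedDeriv_smul_smul {f : E₁ × E₂ → ℂ} {p : E₁ × E₂} (hf : ContDiffAt ℂ 2 f p) (c d : ℂ)
    (h : E₁) (k : E₂) : mixedDeriv f p (c • h) (d • k) = c * mixedDeriv f p h k * d := by
  rw [mixedDeriv_eq hf, mixedDeriv_eq hf,
    show ((c • h, 0) : E₁ × E₂) = c • (h, 0) by simp,
    show ((0, d • k) : E₁ × E₂) = d • (0, k) by simp, map_smul, map_smul]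
  simp only [smul_apply, smul_eq_mul]
  ring

theorem eventually_norm_smul_lt {E : Type*} [NormedAddCommGroup E] [NormedSpace ℂ E] {δ : ℝ}
    (hδ : 0 < δ) (v : E) : ∀ᶠ s : ℝ in 𝓝[>] 0, ‖(s : ℂ) • v‖ < δ := by
  have hc : Continuous fun s : ℝ => ‖(s : ℂ) • v‖ := by fun_prop
  have := hc.tendsto 0
  simp only [Complex.ofReal_zero, zero_smul, norm_zero] at this
  exact (this.eventually_lt_const hδ).filter_mono nhdsWithin_le_nhds

/-- The mixed derivative as a limit of second difference quotients. -/
theorem tendsto_second_difference {f : E₁ × E₂ → ℂ} {p : E₁ × E₂} (hf : ContDiffAt ℂ 2 f p)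
    (h : E₁) (k : E₂) :
    Tendsto (fun s : ℝ => (s : ℂ)⁻¹ * (s : ℂ)⁻¹ * (f (p.1 + (s : ℂ) • h, p.2 + (s : ℂ) • k) -
      f (p.1 + (s : ℂ) • h, p.2) - f (p.1, p.2 + (s : ℂ) • k) + f p)) (𝓝[>] 0)
      (𝓝 (mixedDeriv f p h k)) := by
  rw [Metric.tendsto_nhds]
  intro ε hε
  -- The summand 1 keeps the denominator positive when h or k is zero.
  have hC : 0 < ‖h‖ * ‖k‖ + 1 := by positivity
  obtain ⟨δ, hδ, hb⟩ := exists_norm_second_difference_le hf (div_pos hε hC)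
  filter_upwards [eventually_norm_smul_lt hδ h, eventually_norm_smul_lt hδ k, self_mem_nhdsWithin] with s hs1 hs2 hs
  have hs0 : (0 : ℝ) < s := hs
  have hsc : (s : ℂ) ≠ 0 := by exact_mod_cast hs0.ne'
  have h1 := hb _ _ hs1 hs2
  rw [mixedDeriv_smul_smul hf, norm_smul, norm_smul, Complex.norm_real,
    Real.norm_of_nonneg hs0.le] at h1
  set D := f (p.1 + (s : ℂ) • h, p.2 + (s : ℂ) • k) -
      f (p.1 + (s : ℂ) • h, p.2) - f (p.1, p.2 + (s : ℂ) • k) + f p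
  have h2 : (s : ℂ)⁻¹ * (s : ℂ)⁻¹ * D - mixedDeriv f p h k =
      (s : ℂ)⁻¹ * (s : ℂ)⁻¹ * (D - s * mixedDeriv f p h k * s) := by
    field_simp
  rw [dist_eq_norm, h2, norm_mul, norm_mul, norm_inv, Complex.norm_real,
    Real.norm_of_nonneg hs0.le]
  calc s⁻¹ * s⁻¹ * ‖D - s * mixedDeriv f p h k * s‖
      ≤ s⁻¹ * s⁻¹ * (ε / (‖h‖ * ‖k‖ + 1) * (s * ‖h‖) * (s * ‖k‖)) := by gcongr
    _ = ε * ((‖h‖ * ‖k‖) / (‖h‖ * ‖k‖ + 1)) := by field_simp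
    _ < ε * 1 := by
      refine mul_lt_mul_of_pos_left ?_ hε
      rw [div_lt_one hC]
      linarith
    _ = ε := mul_one ε

end SeveralComplexVariables

/-! ### From infinite divisibility to a positive definite Hessian -/

namespace CowenDouglas

open Metric Set Filter Topology SeveralComplexVariables

variable {m : ℕ}

theorem sesquiHolomorphicOn_unitBall {F : Cn m → Cn m → ℂ} :
    SesquiHolomorphicOn (unitBall m) F ↔
      DifferentiableOn ℂ (fun p : Cn m × Cn m => F p.1 (conjVec p.2))
        (ball 0 1 ×ˢ ball 0 1) := by
  rw [SesquiHolomorphicOn, conjVec_preimage_ball]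

/-- The matrix of mixed derivatives `∂²Φ / ∂z_i ∂u_j`. -/
noncomputable def mixedMatrix (Φ : Cn m × Cn m → ℂ) (p : Cn m × Cn m) : Matrix (Fin m) (Fin m) ℂ :=
  Matrix.of fun i j => mixedDeriv Φ p (EuclideanSpace.single i 1) (EuclideanSpace.single j 1)

theorem contDiffAt_of_mem_ball {r : ℝ} {Φ : Cn m × Cn m → ℂ}
    (hΦ : DifferentiableOn ℂ Φ (ball 0 r ×ˢ ball 0 r)) {p : Cn m × Cn m}
    (hp : p ∈ ball (0 : Cn m) r ×ˢ ball (0 : Cn m) r) : ContDiffAt ℂ 2 Φ p :=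
  contDiffAt_of_differentiableOn (isOpen_ball.prod isOpen_ball) 2 hΦ hp

/-- If all the powers `exp (t ψ)` are positive definite, `ψ` is conditionally positive definite. -/
theorem sum_nonneg_of_exp {X : Type} {ψ : X → X → ℂ}
    (h : ∀ t : ℝ, 0 < t → (Matrix.of fun x y => Complex.exp ((t : ℂ) * ψ x y)).PosSemidef)
    {ι : Type} [Fintype ι] (x : ι → X) (c : ι → ℂ) (hc : ∑ a, c a = 0) :
    0 ≤ ∑ a, ∑ b, conj (c a) * ψ (x a) (x b) * c b := by
  have hd : ∀ y : ℂ, Tendsto (fun t : ℝ => (t : ℂ)⁻¹ * (Complex.exp (t * y) - 1)) (𝓝[>] 0)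
      (𝓝 y) := by
    intro y
    have h1 : HasDerivAt (fun t : ℂ => Complex.exp (t * y)) y 0 := by
      have := ((hasDerivAt_id (0 : ℂ)).mul_const y).cexp
      simpa using this
    have h2 := h1.comp_ofReal.tendsto_slope_zero_right
    simpa using h2
  have ht : Tendsto (fun t : ℝ => ∑ a, ∑ b,
      conj (c a) * ((t : ℂ)⁻¹ * (Complex.exp (t * ψ (x a) (x b)) - 1)) * c b) (𝓝[>] 0)
      (𝓝 (∑ a, ∑ b, conj (c a) * ψ (x a) (x b) * c b)) :=
    tendsto_finsetSum _ fun a _ => tendsto_finsetSum _ fun b _ =>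
      ((hd _).const_mul _).mul_const _
  refine ge_of_tendsto ht ?_
  filter_upwards [self_mem_nhdsWithin] with t ht0
  have ht0' : (0 : ℝ) < t := ht0
  have h3 := (h t ht0).sum_nonneg x c
  have h4 : ∑ a, ∑ b, conj (c a) * ((t : ℂ)⁻¹ * (Complex.exp (t * ψ (x a) (x b)) - 1)) * c b =
      (t : ℂ)⁻¹ * ∑ a, ∑ b, conj (c a) * Complex.exp (t * ψ (x a) (x b)) * c b := by
    -- Because the coefficients sum to zero, the constant 1 subtracted from the exponential
    -- contributes nothing, and the form is t⁻¹ times a nonnegative one.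
    have h5 : ∑ a, ∑ b, conj (c a) * c b = 0 := by
      rw [← Finset.sum_mul_sum, hc, mul_zero]
    rw [← sub_zero (∑ a, ∑ b, conj (c a) * Complex.exp (t * ψ (x a) (x b)) * c b), ← h5,
      ← Finset.sum_sub_distrib, Finset.mul_sum]
    refine Finset.sum_congr rfl fun a _ => ?_
    rw [← Finset.sum_sub_distrib, Finset.mul_sum]
    exact Finset.sum_congr rfl fun b _ => by ring
  rw [h4]
  refine mul_nonneg ?_ h3
  rw [← Complex.ofReal_inv]
  exact Complex.zero_le_real.mpr (inv_nonneg.mpr ht0'.le)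

/-- The mixed derivatives of a conditionally positive definite kernel form a positive definite
matrix valued kernel. -/
theorem isPosDefMatrixKernel_mixedMatrix {ψ : Cn m → Cn m → ℂ}
    (hψ : SesquiHolomorphicOn (unitBall m) ψ)
    (h : ∀ (ι : Type) [Fintype ι] (x : ι → unitBall m) (c : ι → ℂ), ∑ a, c a = 0 →
      0 ≤ ∑ a, ∑ b, conj (c a) * ψ (x a) (x b) * c b) :
    IsPosDefMatrixKernel (unitBall m) fun z w =>
      mixedMatrix (fun p => ψ p.1 (conjVec p.2)) (z, conjVec w) := by
  refine Matrix.PosSemidef.of_sum_nonneg fun ι _ x c => ?_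
  set Ψ : Cn m × Cn m → ℂ := fun p => ψ p.1 (conjVec p.2) with hΨ
  have hC : ∀ a b, ContDiffAt ℂ 2 Ψ (((x a).1 : Cn m), conjVec ((x b).1 : Cn m)) := fun a b =>
    contDiffAt_of_mem_ball (sesquiHolomorphicOn_unitBall.mp hψ)
      ⟨(x a).1.2, conjVec_mem_ball.mpr (x b).1.2⟩
  -- The coefficients are absorbed into directions, which turns each term of the quadratic form into
  -- one mixed derivative.
  set v : ι → Cn m := fun a => conj (c a) • EuclideanSpace.single (x a).2 (1 : ℂ) with hv
  have hterm : ∀ a b, conj (c a) * mixedMatrix Ψ ((x a).1, conjVec (x b).1) (x a).2 (x b).2 * c b =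
      mixedDeriv Ψ ((x a).1, conjVec (x b).1) (v a) (conjVec (v b)) := by
    intro a b
    simp only [hv, conjVec_smul, conjVec_single_one, Complex.conj_conj]
    rw [mixedDeriv_smul_smul (hC a b)]
    rfl
  have ht := tendsto_finsetSum Finset.univ fun a (_ : a ∈ Finset.univ) =>
    tendsto_finsetSum Finset.univ fun b (_ : b ∈ Finset.univ) =>
      tendsto_second_difference (hC a b) (v a) (conjVec (v b))
  simp only [Matrix.of_apply, hterm]
  refine ge_of_tendsto ht ?_
  have hmem : ∀ᶠ s : ℝ in 𝓝[>] 0, ∀ a, ((x a).1 : Cn m) + (s : ℂ) • v a ∈ unitBall m := by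
    refine eventually_all.mpr fun a => ?_
    have hc : Continuous fun s : ℝ => ((x a).1 : Cn m) + (s : ℂ) • v a := by fun_prop
    refine (hc.continuousAt.eventually (isOpen_ball.mem_nhds ?_)).filter_mono nhdsWithin_le_nhds
    simp
  filter_upwards [hmem] with s hs
  -- Doubling the family, with weight s⁻¹ at the displaced points and -s⁻¹ at the original ones,
  -- gives coefficients of sum zero, and the form becomes the sum of the second difference
  -- quotients.
  have h1 := h (ι ⊕ ι) (Sum.elim (fun a => ⟨_, hs a⟩) fun a => (x a).1)
    (Sum.elim (fun _ => (s : ℂ)⁻¹) fun _ => -(s : ℂ)⁻¹) (by simp)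
  refine h1.trans_eq ?_
  simp only [Fintype.sum_sum_type, Sum.elim_inl, Sum.elim_inr, ← Finset.sum_add_distrib]
  refine Finset.sum_congr rfl fun a _ => Finset.sum_congr rfl fun b _ => ?_
  have h2 : conjVec (conjVec ((x b).1 : Cn m) + (s : ℂ) • conjVec (v b)) =
      ((x b).1 : Cn m) + (s : ℂ) • v b := by
    rw [conjVec_add, conjVec_smul, conjVec_conjVec, conjVec_conjVec, Complex.conj_ofReal]
  simp only [hΨ, h2, conjVec_conjVec, map_neg, map_inv₀, Complex.conj_ofReal]
  ring

/-- The implication from (iii) to (i). Since the logarithm is real on the diagonal, it polarizes log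
L(w, w), and its mixed derivatives are the required polarization of the Hessian. -/
theorem isPosDefFunction_of_isInfinitelyDivisible {L : Cn m → Cn m → ℂ}
    (hL : IsInfinitelyDivisible (unitBall m) L) :
    IsPosDefFunction (unitBall m) (hessLog fun w => (L w w).re) := by
  obtain ⟨ψ, hψ, hre, hexp, hpos⟩ := hL
  refine ⟨fun z w => mixedMatrix (fun p => ψ p.1 (conjVec p.2)) (z, conjVec w), fun i j => ?_,
    fun w hw => ?_, isPosDefMatrixKernel_mixedMatrix hψ fun ι _ x c hc => ?_⟩
  · rw [sesquiHolomorphicOn_unitBall] at hψ ⊢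
    have := differentiableOn_mixedDeriv (isOpen_ball.prod isOpen_ball) hψ
      (EuclideanSpace.single i 1) (EuclideanSpace.single j 1)
    simpa only [mixedMatrix, Matrix.of_apply, conjVec_conjVec] using this
  · ext i j
    refine (hessLog_eq_mixedDeriv (isOpen_ball.prod isOpen_ball)
      ⟨hw, conjVec_mem_ball.mpr hw⟩ (sesquiHolomorphicOn_unitBall.mp hψ) ?_ i j).symm
    filter_upwards [isOpen_ball.mem_nhds hw] with v hv
    have h1 : ψ v v = ((ψ v v).re : ℂ) := by
      refine Complex.ext rfl ?_
      rw [hre v hv, Complex.ofReal_im]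
    rw [← hexp v hv v hv, conjVec_conjVec, h1, ← Complex.ofReal_exp, Complex.ofReal_re,
      Real.log_exp]
  · exact sum_nonneg_of_exp (X := unitBall m) (ψ := fun z w => ψ z w) hpos x c hc

end CowenDouglas

/-! ### Averages along rays and the fundamental theorem of calculus in two variables -/

namespace SeveralComplexVariables

open Metric Set Filter Topology

section Averages

variable {E₁ E₂ : Type*} [NormedAddCommGroup E₁] [NormedSpace ℂ E₁]
  [NormedAddCommGroup E₂] [NormedSpace ℂ E₂]

/-- The average of `f` over the segment from `(0, u)` to `(z, u)`. -/
noncomputable def averageFst (f : E₁ × E₂ → ℂ) (q : E₁ × E₂) : ℂ :=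
  ∫ s in (0 : ℝ)..1, f ((s : ℂ) • q.1, q.2)

/-- The average of `f` over the segment from `(z, 0)` to `(z, u)`. -/
noncomputable def averageSnd (f : E₁ × E₂ → ℂ) (q : E₁ × E₂) : ℂ :=
  ∫ t in (0 : ℝ)..1, f (q.1, (t : ℂ) • q.2)

theorem smul_mem_ball {E : Type*} [NormedAddCommGroup E] [NormedSpace ℂ E] {r s : ℝ} {v : E}
    (hv : v ∈ ball (0 : E) r) (hs : s ∈ Icc (0 : ℝ) 1) : (s : ℂ) • v ∈ ball (0 : E) r := by
  rw [mem_ball_zero_iff] at hv ⊢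
  rw [norm_smul, Complex.norm_real, Real.norm_of_nonneg hs.1]
  exact (mul_le_of_le_one_left (norm_nonneg v) hs.2).trans_lt hv

variable {r : ℝ} {f : E₁ × E₂ → ℂ}

theorem continuousOn_smul_fst (hf : DifferentiableOn ℂ f (ball 0 r ×ˢ ball 0 r)) {q : E₁ × E₂}
    (hq : q ∈ ball (0 : E₁) r ×ˢ ball (0 : E₂) r) :
    ContinuousOn (fun s : ℝ => f ((s : ℂ) • q.1, q.2)) (uIcc 0 1) := by
  rw [uIcc_of_le zero_le_one]
  exact hf.continuousOn.comp (by fun_prop) fun s hs => ⟨smul_mem_ball hq.1 hs, hq.2⟩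

theorem continuousOn_smul_snd (hf : DifferentiableOn ℂ f (ball 0 r ×ˢ ball 0 r)) {q : E₁ × E₂}
    (hq : q ∈ ball (0 : E₁) r ×ˢ ball (0 : E₂) r) :
    ContinuousOn (fun t : ℝ => f (q.1, (t : ℂ) • q.2)) (uIcc 0 1) := by
  rw [uIcc_of_le zero_le_one]
  exact hf.continuousOn.comp (by fun_prop) fun s hs => ⟨hq.1, smul_mem_ball hq.2 hs⟩

/-- The fundamental theorem of calculus in both variables. -/
theorem integral_integral_mixedDeriv (hf : DifferentiableOn ℂ f (ball 0 r ×ˢ ball 0 r))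
    {z : E₁} {u : E₂} (hz : z ∈ ball (0 : E₁) r) (hu : u ∈ ball (0 : E₂) r) :
    ∫ t in (0 : ℝ)..1, ∫ s in (0 : ℝ)..1, mixedDeriv f ((s : ℂ) • z, (t : ℂ) • u) z u =
      f (z, u) - f (z, 0) - f (0, u) + f (0, 0) := by
  have hopen : IsOpen (ball (0 : E₁) r ×ˢ ball (0 : E₂) r) := isOpen_ball.prod isOpen_ball
  have h0 : (0 : E₁) ∈ ball (0 : E₁) r := mem_ball_self (pos_of_mem_ball hz)
  set g : E₁ × E₂ → ℂ := fun q => fderiv ℂ f q (0, u) with hg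
  have hgd : DifferentiableOn ℂ g (ball 0 r ×ˢ ball 0 r) := differentiableOn_fderiv_apply hopen hf _
  have hI : uIcc (0 : ℝ) 1 = Icc 0 1 := uIcc_of_le zero_le_one
  have hin : ∀ t ∈ uIcc (0 : ℝ) 1,
      ∫ s in (0 : ℝ)..1, mixedDeriv f ((s : ℂ) • z, (t : ℂ) • u) z u =
        g (z, (t : ℂ) • u) - g (0, (t : ℂ) • u) := by
    intro t ht
    rw [hI] at ht
    have htu := smul_mem_ball hu ht
    have hderiv : ∀ s ∈ uIcc (0 : ℝ) 1, HasDerivAt (fun s : ℝ => g ((s : ℂ) • z, (t : ℂ) • u))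
        (mixedDeriv f ((s : ℂ) • z, (t : ℂ) • u) z u) s := by
      intro s hs
      rw [hI] at hs
      have h1 : HasFDerivAt g (fderiv ℂ g ((s : ℂ) • z, (t : ℂ) • u))
          ((s : ℂ) • z, (t : ℂ) • u) :=
        (hgd.differentiableAt (hopen.mem_nhds ⟨smul_mem_ball hz hs, htu⟩)).hasFDerivAt
      have h2 : HasDerivAt (fun s : ℂ => (s • z, (t : ℂ) • u)) (z, 0) (s : ℂ) := by
        have := (hasDerivAt_id (s : ℂ)).smul_const z
        rw [one_smul] at this
        exact this.prodMk (hasDerivAt_const _ _)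
      exact (h1.comp_hasDerivAt (s : ℂ) h2).comp_ofReal
    rw [intervalIntegral.integral_eq_sub_of_hasDerivAt hderiv]
    · simp
    · exact (continuousOn_smul_fst (differentiableOn_mixedDeriv hopen hf z u)
        (q := (z, (t : ℂ) • u)) ⟨hz, htu⟩).intervalIntegrable
  rw [intervalIntegral.integral_congr hin]
  have hderiv : ∀ v ∈ ball (0 : E₁) r, ∀ t ∈ uIcc (0 : ℝ) 1,
      HasDerivAt (fun t : ℝ => f (v, (t : ℂ) • u)) (g (v, (t : ℂ) • u)) t := by
    intro v hv t ht
    rw [hI] at ht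
    have h1 : HasFDerivAt f (fderiv ℂ f (v, (t : ℂ) • u)) (v, (t : ℂ) • u) :=
      (hf.differentiableAt (hopen.mem_nhds ⟨hv, smul_mem_ball hu ht⟩)).hasFDerivAt
    have h2 : HasDerivAt (fun t : ℂ => (v, t • u)) (0, u) (t : ℂ) := by
      have := (hasDerivAt_id (t : ℂ)).smul_const u
      rw [one_smul] at this
      exact (hasDerivAt_const _ _).prodMk this
    exact (h1.comp_hasDerivAt (t : ℂ) h2).comp_ofReal
  rw [intervalIntegral.integral_eq_sub_of_hasDerivAt
    (fun t ht => (hderiv z hz t ht).sub (hderiv 0 h0 t ht))]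
  · simp only [Pi.sub_apply, Complex.ofReal_one, one_smul, Complex.ofReal_zero, zero_smul]
    ring
  · exact ((continuousOn_smul_snd hgd (q := (z, u)) ⟨hz, hu⟩).sub
      (continuousOn_smul_snd hgd (q := (0, u)) ⟨h0, hu⟩)).intervalIntegrable

variable [FiniteDimensional ℂ E₁] [FiniteDimensional ℂ E₂]

theorem differentiableOn_averageFst (hf : DifferentiableOn ℂ f (ball 0 r ×ˢ ball 0 r)) :
    DifferentiableOn ℂ (averageFst f) (ball 0 r ×ˢ ball 0 r) := by
  refine differentiableOn_integral_comp (isOpen_ball.prod isOpen_ball) hf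
    (T := fun s => ((s : ℂ) • ContinuousLinearMap.fst ℂ E₁ E₂).prod
      (ContinuousLinearMap.snd ℂ E₁ E₂)) ?_ fun s hs q hq => ⟨smul_mem_ball hq.1 hs, hq.2⟩
  exact continuous_clm_apply.mpr fun q => by simp only [ContinuousLinearMap.prod_apply]; fun_prop

theorem differentiableOn_averageSnd (hf : DifferentiableOn ℂ f (ball 0 r ×ˢ ball 0 r)) :
    DifferentiableOn ℂ (averageSnd f) (ball 0 r ×ˢ ball 0 r) := by
  refine differentiableOn_integral_comp (isOpen_ball.prod isOpen_ball) hf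
    (T := fun s => (ContinuousLinearMap.fst ℂ E₁ E₂).prod
      ((s : ℂ) • ContinuousLinearMap.snd ℂ E₁ E₂)) ?_ fun s hs q hq =>
        ⟨hq.1, smul_mem_ball hq.2 hs⟩
  exact continuous_clm_apply.mpr fun q => by simp only [ContinuousLinearMap.prod_apply]; fun_prop

end Averages

end SeveralComplexVariables

/-! ### The double primitive of a matrix valued kernel -/

namespace CowenDouglas

open Metric Set Filter Topology SeveralComplexVariables

variable {m : ℕ}

theorem mixedDeriv_eq_sum {f : Cn m × Cn m → ℂ} {p : Cn m × Cn m} (hf : ContDiffAt ℂ 2 f p)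
    (z u : Cn m) : mixedDeriv f p z u = ∑ i, ∑ j, z i * u j * mixedMatrix f p i j := by
  have hbasis : ∀ v : Cn m, v = ∑ i, v i • EuclideanSpace.single i (1 : ℂ) := by
    intro v
    ext k
    simp [WithLp.ofLp_sum, Finset.sum_apply, Pi.single_apply]
  simp only [mixedMatrix, Matrix.of_apply, mixedDeriv_eq hf]
  set B := fderiv ℂ (fderiv ℂ f) p
  have h1 : ∀ v : Cn m, ((v, 0) : Cn m × Cn m) = ∑ i, v i • (EuclideanSpace.single i (1 : ℂ), 0) := by
    intro v
    conv_lhs => rw [hbasis v]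
    rw [Prod.ext_iff]
    simp [Prod.fst_sum, Prod.snd_sum]
  have h2 : ∀ v : Cn m, ((0, v) : Cn m × Cn m) = ∑ i, v i • (0, EuclideanSpace.single i (1 : ℂ)) := by
    intro v
    conv_lhs => rw [hbasis v]
    rw [Prod.ext_iff]
    simp [Prod.fst_sum, Prod.snd_sum]
  rw [h1 z, map_sum, sum_apply]
  refine Finset.sum_congr rfl fun i _ => ?_
  rw [map_smul, smul_apply, h2 u, map_sum, Finset.smul_sum]
  refine Finset.sum_congr rfl fun j _ => ?_
  rw [map_smul, smul_eq_mul, smul_eq_mul]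
  ring

/-- The double primitive `∑ z_i u_j ∫∫ F_ij(s z, t ū) ds dt` of a matrix valued kernel, in
holomorphic coordinates. -/
noncomputable def doublePrimitive (F : Cn m → Cn m → Matrix (Fin m) (Fin m) ℂ)
    (p : Cn m × Cn m) : ℂ :=
  ∑ i, ∑ j, p.1 i * p.2 j *
    averageSnd (averageFst fun q : Cn m × Cn m => F q.1 (conjVec q.2) i j) p

theorem differentiableOn_doublePrimitive {F : Cn m → Cn m → Matrix (Fin m) (Fin m) ℂ}
    (hF : ∀ i j, SesquiHolomorphicOn (unitBall m) fun z w => F z w i j) :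
    DifferentiableOn ℂ (doublePrimitive F) (ball 0 1 ×ˢ ball 0 1) := by
  refine DifferentiableOn.fun_sum fun i _ => DifferentiableOn.fun_sum fun j _ =>
    DifferentiableOn.mul (Differentiable.differentiableOn (by fun_prop)) ?_
  exact differentiableOn_averageSnd (differentiableOn_averageFst
    (sesquiHolomorphicOn_unitBall.mp (hF i j)))

/-- The double primitive of a positive definite matrix valued kernel is positive definite. -/
theorem isPosDefKernel_doublePrimitive {F : Cn m → Cn m → Matrix (Fin m) (Fin m) ℂ}
    (hF : ∀ i j, SesquiHolomorphicOn (unitBall m) fun z w => F z w i j)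
    (hpos : IsPosDefMatrixKernel (unitBall m) F) :
    IsPosDefKernel (unitBall m) fun z w => doublePrimitive F (z, conjVec w) := by
  obtain ⟨H, _, _, _, k, hk⟩ := Matrix.PosSemidef.exists_inner hpos
  -- Clamping the parameter to [0, 1] makes the curves of Gram vectors defined and continuous on all
  -- of ℝ without changing the integrals.
  let σ : ℝ → ℝ := fun s => projIcc (0 : ℝ) 1 zero_le_one s
  have hσc : Continuous σ := continuous_subtype_val.comp continuous_projIcc
  have hσ : ∀ s, σ s ∈ Icc (0 : ℝ) 1 := fun s => (projIcc (0 : ℝ) 1 zero_le_one s).2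
  have hσid : ∀ s ∈ Icc (0 : ℝ) 1, σ s = s := fun s hs => by
    simp only [σ, projIcc_of_mem zero_le_one hs]
  let κ : unitBall m → Fin m → ℝ → H := fun z i s =>
    k (⟨(σ s : ℂ) • (z : Cn m), smul_mem_ball z.2 (hσ s)⟩, i)
  have hκ : ∀ z w i j s t, inner ℂ (κ z i s) (κ w j t) =
      F ((σ s : ℂ) • (z : Cn m)) ((σ t : ℂ) • (w : Cn m)) i j := fun z w i j s t => hk _ _
  have hκc : ∀ z i, Continuous (κ z i) := by
    intro z i
    refine continuous_of_continuous_inner ?_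
    simp only [hκ]
    have h1 := (sesquiHolomorphicOn_unitBall.mp (hF i i)).continuousOn
    have h2 : Continuous fun p : ℝ × ℝ => ((σ p.1 : ℂ) • (z : Cn m),
        conjVec ((σ p.2 : ℂ) • (z : Cn m))) := by
      refine Continuous.prodMk ?_ (continuous_conjVec.comp ?_) <;> fun_prop
    have h3 := h1.comp_continuous h2 fun p =>
      ⟨smul_mem_ball z.2 (hσ _), conjVec_mem_ball.mpr (smul_mem_ball z.2 (hσ _))⟩
    exact h3.congr fun p => by simp only [Function.comp_apply, conjVec_conjVec]
  -- A Gram representation of the double primitive: the Gram vectors of F are integrated along the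
  -- ray to z. The weights are conjugated because the inner product is conjugate linear in its first
  -- argument.
  refine Matrix.PosSemidef.of_inner
    (fun z : unitBall m => ∑ i, conj ((z : Cn m) i) • ∫ s in (0 : ℝ)..1, κ z i s) fun z w => ?_
  simp only [sum_inner, inner_sum, inner_smul_left, inner_smul_right, Complex.conj_conj,
    Matrix.of_apply, doublePrimitive, Finset.mul_sum]
  rw [Finset.sum_comm]
  refine Finset.sum_congr rfl fun i _ => Finset.sum_congr rfl fun j _ => ?_
  rw [inner_intervalIntegral_intervalIntegral (hκc z j) (hκc w i), conjVec_apply, mul_left_comm,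
    ← mul_assoc]
  congr 1
  rw [averageSnd]
  refine intervalIntegral.integral_congr fun t ht => ?_
  simp only [averageFst]
  refine intervalIntegral.integral_congr fun s hs => ?_
  rw [uIcc_of_le zero_le_one] at hs ht
  simp only [hκ, hσid s hs, hσid t ht, conjVec_smul, conjVec_conjVec, Complex.conj_ofReal]

/-- The double primitive of a matrix of mixed derivatives. -/
theorem doublePrimitive_eq {F : Cn m → Cn m → Matrix (Fin m) (Fin m) ℂ} {r : ℝ}
    {f : Cn m × Cn m → ℂ} (hf : DifferentiableOn ℂ f (ball 0 r ×ˢ ball 0 r))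
    (hF : ∀ q ∈ ball (0 : Cn m) r ×ˢ ball (0 : Cn m) r, F q.1 (conjVec q.2) = mixedMatrix f q)
    {z u : Cn m} (hz : z ∈ ball 0 r) (hu : u ∈ ball 0 r) :
    doublePrimitive F (z, u) = f (z, u) - f (z, 0) - f (0, u) + f (0, 0) := by
  have hopen : IsOpen (ball (0 : Cn m) r ×ˢ ball (0 : Cn m) r) := isOpen_ball.prod isOpen_ball
  have hI : uIcc (0 : ℝ) 1 = Icc 0 1 := uIcc_of_le zero_le_one
  have hΦ : ∀ i j, DifferentiableOn ℂ (fun q : Cn m × Cn m => F q.1 (conjVec q.2) i j)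
      (ball 0 r ×ˢ ball 0 r) := fun i j =>
    (differentiableOn_mixedDeriv hopen hf (EuclideanSpace.single i 1)
      (EuclideanSpace.single j 1)).congr fun q hq => by rw [hF q hq]; rfl
  have hin : ∀ t ∈ uIcc (0 : ℝ) 1,
      ∫ s in (0 : ℝ)..1, mixedDeriv f ((s : ℂ) • z, (t : ℂ) • u) z u =
        ∑ i, ∑ j, z i * u j *
          averageFst (fun q : Cn m × Cn m => F q.1 (conjVec q.2) i j) (z, (t : ℂ) • u) := by
    intro t ht
    rw [hI] at ht
    have htu := smul_mem_ball hu ht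
    have h1 : ∀ s ∈ uIcc (0 : ℝ) 1, mixedDeriv f ((s : ℂ) • z, (t : ℂ) • u) z u =
        ∑ i, ∑ j, z i * u j * F ((s : ℂ) • z) (conjVec ((t : ℂ) • u)) i j := by
      intro s hs
      rw [hI] at hs
      have hmem : ((s : ℂ) • z, (t : ℂ) • u) ∈ ball (0 : Cn m) r ×ˢ ball (0 : Cn m) r :=
        ⟨smul_mem_ball hz hs, htu⟩
      rw [mixedDeriv_eq_sum (contDiffAt_of_mem_ball hf hmem)]
      simp only [← hF _ hmem]
    have h2 : ∀ i j, IntervalIntegrable (fun s : ℝ => z i * u j *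
        F ((s : ℂ) • z) (conjVec ((t : ℂ) • u)) i j) MeasureTheory.volume 0 1 := fun i j =>
      (continuousOn_const.mul (continuousOn_smul_fst (hΦ i j) (q := (z, (t : ℂ) • u))
        ⟨hz, htu⟩)).intervalIntegrable
    rw [intervalIntegral.integral_congr h1, intervalIntegral.integral_finsetSum fun i _ => ?_]
    · refine Finset.sum_congr rfl fun i _ => ?_
      rw [intervalIntegral.integral_finsetSum fun j _ => h2 i j]
      refine Finset.sum_congr rfl fun j _ => ?_
      rw [intervalIntegral.integral_const_mul]
      rfl
    · simpa only [Finset.sum_fn] using IntervalIntegrable.sum Finset.univ fun j _ => h2 i j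
  rw [← integral_integral_mixedDeriv hf hz hu, intervalIntegral.integral_congr hin]
  have h3 : ∀ i j, IntervalIntegrable (fun t : ℝ => z i * u j *
      averageFst (fun q : Cn m × Cn m => F q.1 (conjVec q.2) i j) (z, (t : ℂ) • u))
      MeasureTheory.volume 0 1 := fun i j =>
    (continuousOn_const.mul (continuousOn_smul_snd (differentiableOn_averageFst (hΦ i j))
      (q := (z, u)) ⟨hz, hu⟩)).intervalIntegrable
  rw [intervalIntegral.integral_finsetSum fun i _ => ?_]
  · refine Finset.sum_congr rfl fun i _ => ?_
    rw [intervalIntegral.integral_finsetSum fun j _ => h3 i j]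
    refine Finset.sum_congr rfl fun j _ => ?_
    rw [intervalIntegral.integral_const_mul]
    rfl
  · simpa only [Finset.sum_fn] using IntervalIntegrable.sum Finset.univ fun j _ => h3 i j

end CowenDouglas

/-! ### From a positive definite Hessian to infinite divisibility -/

namespace CowenDouglas

open Metric Set Filter Topology SeveralComplexVariables

variable {m : ℕ}

theorem ofReal_log_re {x : ℂ} (hx : 0 < x) : ((Real.log x.re : ℝ) : ℂ) = Complex.log x := by
  have h := Complex.pos_iff.mp hx
  have h1 : x = (x.re : ℂ) := Complex.ext rfl (by simp [← h.2])
  conv_rhs => rw [h1]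
  rw [Complex.ofReal_log h.1.le]

theorem mem_slitPlane_of_pos {x : ℂ} (hx : 0 < x) : x ∈ Complex.slitPlane :=
  Complex.mem_slitPlane_iff.mpr (Or.inl (Complex.pos_iff.mp hx).1)

/-- The complex Hessian of the logarithm of a positive function with polarization `N` is given by
the mixed derivatives of `log N`. -/
theorem hessLog_eq_mixedMatrix_log {L : Cn m → Cn m → ℂ} (hL : SesquiHolomorphicOn (unitBall m) L)
    (hpos : ∀ w ∈ unitBall m, 0 < L w w) {w : Cn m} (hw : w ∈ unitBall m) :
    ContDiffAt ℂ 2 (fun p : Cn m × Cn m => Complex.log (L p.1 (conjVec p.2))) (w, conjVec w) ∧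
    hessLog (fun v => (L v v).re) w =
      mixedMatrix (fun p => Complex.log (L p.1 (conjVec p.2))) (w, conjVec w) := by
  rw [sesquiHolomorphicOn_unitBall] at hL
  have hopen : IsOpen (ball (0 : Cn m) 1 ×ˢ ball (0 : Cn m) 1) := isOpen_ball.prod isOpen_ball
  set Λ : Cn m × Cn m → ℂ := fun p => L p.1 (conjVec p.2) with hΛ
  have hwm : (w, conjVec w) ∈ ball (0 : Cn m) 1 ×ˢ ball (0 : Cn m) 1 :=
    ⟨hw, conjVec_mem_ball.mpr hw⟩
  have hΛw : Λ (w, conjVec w) ∈ Complex.slitPlane := by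
    simp only [hΛ, conjVec_conjVec]
    exact mem_slitPlane_of_pos (hpos w hw)
  have hU := hL.continuousOn.isOpen_inter_preimage hopen Complex.isOpen_slitPlane
  have hd : DifferentiableOn ℂ (fun p => Complex.log (Λ p))
      (ball (0 : Cn m) 1 ×ˢ ball (0 : Cn m) 1 ∩ Λ ⁻¹' Complex.slitPlane) :=
    (hL.mono inter_subset_left).clog fun p hp => hp.2
  refine ⟨contDiffAt_of_differentiableOn hU 2 hd ⟨hwm, hΛw⟩, ?_⟩
  ext i j
  refine hessLog_eq_mixedDeriv hU ⟨hwm, hΛw⟩ hd ?_ i j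
  filter_upwards [isOpen_ball.mem_nhds hw] with v hv
  simp only [hΛ, conjVec_conjVec]
  exact ofReal_log_re (hpos v hv)

/-- The implication from (i) to (iii). No zero-freeness of L off the diagonal is assumed; it comes
out of the factorization through exp P, which at the same time exhibits the logarithm. -/
theorem isInfinitelyDivisible_of_isPosDefFunction {L : Cn m → Cn m → ℂ}
    (hL : SesquiHolomorphicOn (unitBall m) L)
    (hherm : ∀ z ∈ unitBall m, ∀ w ∈ unitBall m, conj (L w z) = L z w)
    (hpos : ∀ w ∈ unitBall m, 0 < L w w)
    (h : IsPosDefFunction (unitBall m) (hessLog fun w => (L w w).re)) :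
    IsInfinitelyDivisible (unitBall m) L := by
  obtain ⟨F, hF, hFd, hFpos⟩ := h
  have hL' := sesquiHolomorphicOn_unitBall.mp hL
  set Λ : Cn m × Cn m → ℂ := fun p => L p.1 (conjVec p.2) with hΛ
  have hopen : ∀ r, IsOpen (ball (0 : Cn m) r ×ˢ ball (0 : Cn m) r) := fun r =>
    isOpen_ball.prod isOpen_ball
  have h0 : (0 : Cn m) ∈ unitBall m := mem_ball_self one_pos
  have hΛ0 : Λ (0, 0) = L 0 0 := by simp only [hΛ, conjVec_zero]
  have hΛ0pos : 0 < Λ (0, 0) := hΛ0 ▸ hpos 0 h0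
  set P := doublePrimitive F with hP
  have hPd : DifferentiableOn ℂ P (ball 0 1 ×ˢ ball 0 1) := differentiableOn_doublePrimitive hF
  -- `Λ` on `{(z, 0)}` and on `{(0, u)}`
  have hΛ1 : DifferentiableOn ℂ (fun z => Λ (z, 0)) (ball 0 1) :=
    hL'.comp (f := fun z : Cn m => (z, (0 : Cn m))) (by fun_prop) fun z hz => ⟨hz, h0⟩
  have hΛ2 : DifferentiableOn ℂ (fun u => Λ (0, u)) (ball 0 1) :=
    hL'.comp (f := fun z : Cn m => ((0 : Cn m), z)) (by fun_prop) fun z hz => ⟨h0, hz⟩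
  -- The formula for P is known only near the origin, where log L exists. Its exponentiated form,
  -- cleared of denominators, is holomorphic everywhere and can be continued by the identity
  -- theorem.
  have key : ∀ p ∈ ball (0 : Cn m) 1 ×ˢ ball (0 : Cn m) 1,
      Complex.exp (P p) * Λ (p.1, 0) * Λ (0, p.2) = Λ p * Λ (0, 0) := by
    intro p hp
    have hdiff : DifferentiableOn ℂ (fun p : Cn m × Cn m =>
        Complex.exp (P p) * Λ (p.1, 0) * Λ (0, p.2) - Λ p * Λ (0, 0)) (ball 0 1 ×ˢ ball 0 1) := by
      refine DifferentiableOn.sub (DifferentiableOn.mul (DifferentiableOn.mul hPd.cexp ?_) ?_)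
        (hL'.mul_const _)
      · exact hΛ1.comp (f := Prod.fst) differentiableOn_fst fun q hq => hq.1
      · exact hΛ2.comp (f := Prod.snd) differentiableOn_snd fun q hq => hq.2
    refine sub_eq_zero.mp (eq_zero_of_eventually_zero hdiff ?_ hp)
    -- a small ball on which the principal logarithm may be used
    have hU := hL'.continuousOn.isOpen_inter_preimage (hopen 1) Complex.isOpen_slitPlane
    obtain ⟨r, hr, hrU⟩ := Metric.isOpen_iff.mp hU (0 : Cn m × Cn m)
      ⟨⟨h0, h0⟩, mem_slitPlane_of_pos hΛ0pos⟩
    rw [show (0 : Cn m × Cn m) = (0, 0) from rfl, ← ball_prod_same] at hrU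
    set Ψ : Cn m × Cn m → ℂ := fun q => Complex.log (Λ q) with hΨ
    have hΨd : DifferentiableOn ℂ Ψ (ball 0 r ×ˢ ball 0 r) :=
      (hL'.mono fun q hq => (hrU hq).1).clog fun q hq => (hrU hq).2
    have hFΨ : ∀ q ∈ ball (0 : Cn m) r ×ˢ ball (0 : Cn m) r,
        F q.1 (conjVec q.2) = mixedMatrix Ψ q := by
      intro q hq
      ext i j
      -- F is prescribed only on the diagonal; two holomorphic functions agreeing on the
      -- anti-diagonal coincide.
      refine sub_eq_zero.mp (eq_zero_of_antidiagonal (r := r)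
        (f := fun q => F q.1 (conjVec q.2) i j - mixedMatrix Ψ q i j) ?_ ?_ hq)
      · exact ((sesquiHolomorphicOn_unitBall.mp (hF i j)).mono fun q hq => (hrU hq).1).sub
          (differentiableOn_mixedDeriv (hopen r) hΨd _ _)
      · intro v hv
        have hv1 : v ∈ unitBall m :=
          (hrU (show (v, conjVec v) ∈ _ from ⟨hv, conjVec_mem_ball.mpr hv⟩)).1.1
        simp only [conjVec_conjVec]
        rw [hFd v hv1, (hessLog_eq_mixedMatrix_log hL hpos hv1).2, sub_self]
    filter_upwards [(hopen r).mem_nhds (show (0 : Cn m × Cn m) ∈ _ from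
      ⟨mem_ball_self hr, mem_ball_self hr⟩)] with q hq
    have hexp : ∀ q ∈ ball (0 : Cn m) r ×ˢ ball (0 : Cn m) r, Complex.exp (Ψ q) = Λ q :=
      fun q hq => Complex.exp_log (Complex.slitPlane_ne_zero (hrU hq).2)
    have hr0 : (0 : Cn m) ∈ ball (0 : Cn m) r := mem_ball_self hr
    rw [sub_eq_zero, show P q = Ψ (q.1, q.2) - Ψ (q.1, 0) - Ψ (0, q.2) + Ψ (0, 0) from
      doublePrimitive_eq hΨd hFΨ hq.1 hq.2, Complex.exp_add, Complex.exp_sub, Complex.exp_sub,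
      hexp (q.1, q.2) hq, hexp (q.1, 0) ⟨hq.1, hr0⟩, hexp (0, q.2) ⟨hr0, hq.2⟩,
      hexp (0, 0) ⟨hr0, hr0⟩]
    have hn1 := Complex.slitPlane_ne_zero
      (hrU (show (q.1, (0 : Cn m)) ∈ _ from ⟨hq.1, hr0⟩)).2
    have hn2 := Complex.slitPlane_ne_zero
      (hrU (show ((0 : Cn m), q.2) ∈ _ from ⟨hr0, hq.2⟩)).2
    field_simp
  have hne : ∀ z ∈ ball (0 : Cn m) 1, Λ (z, 0) ≠ 0 := by
    intro z hz hzero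
    -- At a diagonal point the right-hand side of `key` is L(z, z) L(0, 0), which is not zero.
    have h1 := key (z, conjVec z) ⟨hz, conjVec_mem_ball.mpr hz⟩
    simp only [hzero, mul_zero, zero_mul] at h1
    have h2 : Λ (z, conjVec z) = L z z := by simp only [hΛ, conjVec_conjVec]
    rw [h2] at h1
    exact mul_ne_zero (hpos z hz).ne' hΛ0pos.ne' h1.symm
  set c : ℝ := Real.log (L 0 0).re with hc
  have hcexp : Complex.exp (c : ℂ) = Λ (0, 0) := by
    rw [hc, ofReal_log_re (hpos 0 h0), Complex.exp_log (hpos 0 h0).ne', hΛ0]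
  obtain ⟨g, hg, hgexp, -⟩ := exists_differentiableOn_log isOpen_ball (convex_ball (0 : Cn m) 1)
    hΛ1 hne h0 hcexp
  have hPpos := isPosDefKernel_doublePrimitive hF hFpos
  -- Only the slice z ↦ L(z, 0) needs a logarithm g: by Hermitian symmetry conj (g w) is one for
  -- L(0, w), and `key` supplies the rest.
  refine ⟨fun z w => P (z, conjVec w) + g z + conj (g w) - c, ?_, fun w hw => ?_,
    fun z hz w hw => ?_, fun t ht => ?_⟩
  · rw [sesquiHolomorphicOn_unitBall]
    simp only [conjVec_conjVec]
    refine DifferentiableOn.sub_const (DifferentiableOn.add (DifferentiableOn.add hPd ?_) ?_) _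
    · exact hg.comp (f := Prod.fst) differentiableOn_fst fun q hq => hq.1
    · have h1 : DifferentiableOn ℂ (fun u : Cn m => conj (g (conjVec u))) (ball 0 1) := by
        intro u hu
        refine (differentiableAt_conj_comp_conjVec ?_).differentiableWithinAt
        exact hg.differentiableAt (isOpen_ball.mem_nhds (conjVec_mem_ball.mpr hu))
      exact h1.comp (f := Prod.snd) differentiableOn_snd fun q hq => hq.2
  · have h1 : conj (P (w, conjVec w)) = P (w, conjVec w) :=
      hPpos.1.apply (⟨w, hw⟩ : unitBall m) ⟨w, hw⟩
    have h2 := congrArg Complex.im h1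
    rw [Complex.conj_im] at h2
    simp only [Complex.sub_im, Complex.add_im, Complex.conj_im, Complex.ofReal_im]
    linarith
  · have h1 := key (z, conjVec w) ⟨hz, conjVec_mem_ball.mpr hw⟩
    have h2 : conj (Λ (w, 0)) = Λ (0, conjVec w) := by
      simp only [hΛ, conjVec_zero, conjVec_conjVec]
      exact hherm 0 h0 w hw
    rw [Complex.exp_sub, Complex.exp_add, Complex.exp_add, hgexp z hz, Complex.exp_conj,
      hgexp w hw, h2, hcexp, h1, mul_div_cancel_right₀ _ hΛ0pos.ne']
    simp only [hΛ, conjVec_conjVec]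
  · have h1 := (Matrix.PosSemidef.smul hPpos (Complex.zero_le_real.mpr ht.le)).hadamard_exp
    -- Splitting c evenly between the two variables makes the remaining factor of L^t a rank one
    -- kernel f(z) conj (f(w)).
    have h2 := Matrix.PosSemidef.of_rank_one
      fun z : unitBall m => Complex.exp ((t : ℂ) * (g z - (c / 2 : ℝ)))
    have h3 := h1.hadamard h2
    refine cast (congrArg Matrix.PosSemidef ?_) h3
    ext z w
    simp only [Matrix.hadamard_apply, Matrix.of_apply, Matrix.smul_apply, smul_eq_mul,
      ← Complex.exp_conj, ← Complex.exp_add, map_mul, map_sub, Complex.conj_ofReal]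
    congr 1
    push_cast
    ring

end CowenDouglas

/-! ### Holomorphy of Hilbert space valued maps from their Gram kernels -/

open Filter Topology in
/-- A map into a Hilbert space whose Gram kernel has a sesquilinear second order expansion is
differentiable. -/
theorem exists_linearMap_of_inner_expansion {E H : Type*} [NormedAddCommGroup E] [NormedSpace ℂ E]
    [NormedAddCommGroup H] [InnerProductSpace ℂ H] [CompleteSpace H] {δ : E → H} {S : E → E → ℂ}
    (hadd₁ : ∀ x y z, S (x + y) z = S x z + S y z) (hadd₂ : ∀ x y z, S x (y + z) = S x y + S x z)
    (hsmul₁ : ∀ (c : ℂ) x y, S (c • x) y = conj c * S x y)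
    (hsmul₂ : ∀ (c : ℂ) x y, S x (c • y) = c * S x y)
    (hS : ∀ ε > 0, ∃ ρ > 0, ∀ h k, ‖h‖ < ρ → ‖k‖ < ρ →
      ‖inner ℂ (δ h) (δ k) - S h k‖ ≤ ε * ‖h‖ * ‖k‖) :
    ∃ D : E →ₗ[ℂ] H, ∀ ε > 0, ∃ ρ > 0, ∀ h, ‖h‖ < ρ → ‖δ h - D h‖ ≤ ε * ‖h‖ := by
  have hsq : ∀ x y : H, ‖x - y‖ ^ 2 = (inner ℂ x x).re - (inner ℂ x y).re - (inner ℂ y x).re +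
      (inner ℂ y y).re := by
    intro x y
    rw [← inner_self_eq_norm_sq (𝕜 := ℂ), inner_sub_sub_self]
    simp
  let s : ℕ → ℂ := fun n => ((1 / ((n : ℝ) + 1) : ℝ) : ℂ)
  have hs0 : ∀ n, s n ≠ 0 := fun n => by
    simp only [s]
    exact_mod_cast (by positivity : (1 / ((n : ℝ) + 1)) ≠ 0)
  have hsc : ∀ n, conj (s n) = s n := fun n => Complex.conj_ofReal _
  have hst : Tendsto s atTop (𝓝 0) := by
    have := (Complex.continuous_ofReal.tendsto 0).comp
      (tendsto_one_div_add_atTop_nhds_zero_nat (𝕜 := ℝ))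
    rw [Complex.ofReal_zero] at this
    exact this
  -- Difference quotients along e with real steps 1 / (n + 1); their limits d e will be the values
  -- of the derivative.
  let q : E → ℕ → H := fun e n => (s n)⁻¹ • δ (s n • e)
  have hsmall : ∀ (e : E) {ρ : ℝ}, 0 < ρ → ∀ᶠ n in atTop, ‖s n • e‖ < ρ := by
    intro e ρ hρ
    have h1 : Tendsto (fun n => ‖s n • e‖) atTop (𝓝 0) := by
      simpa using (hst.smul_const e).norm
    exact h1.eventually_lt_const hρ
  have hqS : ∀ (e h : E) (n : ℕ) (ε : ℝ), ‖inner ℂ (δ h) (δ (s n • e)) - S h (s n • e)‖ ≤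
      ε * ‖h‖ * ‖s n • e‖ → ‖inner ℂ (δ h) (q e n) - S h e‖ ≤ ε * ‖h‖ * ‖e‖ := by
    intro e h n ε hb
    have h1 : inner ℂ (δ h) (q e n) - S h e =
        (s n)⁻¹ * (inner ℂ (δ h) (δ (s n • e)) - S h (s n • e)) := by
      simp only [q, inner_smul_right, hsmul₂]
      have := hs0 n
      field_simp
    rw [h1, norm_mul, norm_inv]
    rw [norm_smul] at hb
    have h2 : 0 < ‖s n‖ := norm_pos_iff.mpr (hs0 n)
    calc ‖s n‖⁻¹ * ‖inner ℂ (δ h) (δ (s n • e)) - S h (s n • e)‖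
        ≤ ‖s n‖⁻¹ * (ε * ‖h‖ * (‖s n‖ * ‖e‖)) := by gcongr
      _ = ε * ‖h‖ * ‖e‖ := by field_simp
  have hqx : ∀ (e : E) (x : H) (n : ℕ) (ε C : ℝ) (h : E),
      ‖inner ℂ (δ (s n • e)) x - S (s n • e) h‖ ≤ ε * ‖s n • e‖ * C →
        ‖inner ℂ (q e n) x - S e h‖ ≤ ε * ‖e‖ * C := by
    intro e x n ε C h hb
    have h1 : inner ℂ (q e n) x - S e h =
        (s n)⁻¹ * (inner ℂ (δ (s n • e)) x - S (s n • e) h) := by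
      simp only [q, inner_smul_left, hsmul₁, map_inv₀, hsc]
      have := hs0 n
      field_simp
    rw [h1, norm_mul, norm_inv]
    rw [norm_smul] at hb
    have h2 : 0 < ‖s n‖ := norm_pos_iff.mpr (hs0 n)
    calc ‖s n‖⁻¹ * ‖inner ℂ (δ (s n • e)) x - S (s n • e) h‖
        ≤ ‖s n‖⁻¹ * (ε * (‖s n‖ * ‖e‖) * C) := by gcongr
      _ = ε * ‖e‖ * C := by field_simp
  have hcauchy : ∀ e, CauchySeq (q e) := by
    intro e
    rw [Metric.cauchySeq_iff]
    intro η hη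
    -- The square ‖q e a - q e b‖² is an alternating sum of four inner products, each within ε ‖e‖²
    -- of S e e; this choice keeps the total error below η².
    set ε : ℝ := η ^ 2 / (8 * (‖e‖ ^ 2 + 1)) with hε
    have hεpos : 0 < ε := by positivity
    obtain ⟨ρ, hρ, hb⟩ := hS ε hεpos
    obtain ⟨N, hN⟩ := eventually_atTop.mp (hsmall e hρ)
    have hbnd : ∀ a ≥ N, ∀ b ≥ N, ‖inner ℂ (q e a) (q e b) - S e e‖ ≤ ε * ‖e‖ * ‖e‖ := by
      intro a ha b hb'
      exact hqx e _ a ε _ e (hqS e _ b ε (hb _ _ (hN a ha) (hN b hb')))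
    refine ⟨N, fun a ha b hb' => ?_⟩
    have hre : ∀ a ≥ N, ∀ b ≥ N, |(inner ℂ (q e a) (q e b)).re - (S e e).re| ≤ ε * ‖e‖ * ‖e‖ := by
      intro a ha b hb'
      rw [← Complex.sub_re]
      exact (Complex.abs_re_le_norm _).trans (hbnd a ha b hb')
    have h1 := abs_le.mp (hre a ha a ha)
    have h2 := abs_le.mp (hre a ha b hb')
    have h3 := abs_le.mp (hre b hb' a ha)
    have h4 := abs_le.mp (hre b hb' b hb')
    rw [dist_eq_norm]
    refine lt_of_pow_lt_pow_left₀ 2 hη.le ?_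
    rw [hsq]
    have h5 : 4 * (ε * ‖e‖ * ‖e‖) < η ^ 2 := by
      have h6 : 4 * (ε * ‖e‖ * ‖e‖) = η ^ 2 * (‖e‖ ^ 2 / (2 * (‖e‖ ^ 2 + 1))) := by
        rw [hε]; field_simp; ring
      rw [h6]
      have h7 : ‖e‖ ^ 2 / (2 * (‖e‖ ^ 2 + 1)) < 1 := by
        rw [div_lt_one (by positivity)]
        nlinarith [sq_nonneg ‖e‖]
      nlinarith [pow_pos hη 2]
    linarith
  choose d hd using fun e => cauchySeq_tendsto_of_complete (hcauchy e)
  have hδd : ∀ ε > 0, ∃ ρ > 0, ∀ h e, ‖h‖ < ρ → ‖inner ℂ (δ h) (d e) - S h e‖ ≤ ε * ‖h‖ * ‖e‖ := by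
    intro ε hε
    obtain ⟨ρ, hρ, hb⟩ := hS ε hε
    refine ⟨ρ, hρ, fun h e hh => ?_⟩
    have ht : Tendsto (fun n => ‖inner ℂ (δ h) (q e n) - S h e‖) atTop
        (𝓝 ‖inner ℂ (δ h) (d e) - S h e‖) :=
      ((tendsto_const_nhds.inner (hd e)).sub_const _).norm
    refine le_of_tendsto ht ?_
    filter_upwards [hsmall e hρ] with n hn
    exact hqS e h n ε (hb h _ hh hn)
  have hdd : ∀ e f, inner ℂ (d e) (d f) = S e f := by
    intro e f
    have hle : ∀ ε > 0, ‖inner ℂ (d e) (d f) - S e f‖ ≤ ε * ‖e‖ * ‖f‖ := by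
      intro ε hε
      obtain ⟨ρ, hρ, hb⟩ := hδd ε hε
      have ht : Tendsto (fun n => ‖inner ℂ (q e n) (d f) - S e f‖) atTop
          (𝓝 ‖inner ℂ (d e) (d f) - S e f‖) :=
        (((hd e).inner tendsto_const_nhds).sub_const _).norm
      refine le_of_tendsto ht ?_
      filter_upwards [hsmall e hρ] with n hn
      exact hqx e _ n ε _ f (hb _ f hn)
    rw [← sub_eq_zero, ← norm_le_zero_iff]
    refine le_of_forall_pos_le_add fun η hη => ?_
    have h1 := hle (η / (‖e‖ * ‖f‖ + 1)) (by positivity)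
    have h2 : η / (‖e‖ * ‖f‖ + 1) * ‖e‖ * ‖f‖ ≤ η := by
      rw [mul_assoc, div_mul_eq_mul_div, div_le_iff₀ (by positivity)]
      nlinarith [norm_nonneg e, norm_nonneg f]
    linarith
  -- Linearity is automatic: the squared norm of each linearity defect expands by `hdd` into values
  -- of S and vanishes by sesquilinearity.
  let D : E →ₗ[ℂ] H :=
    { toFun := d
      map_add' := fun x y => by
        rw [← sub_eq_zero, ← inner_self_eq_zero (𝕜 := ℂ)]
        simp only [inner_sub_left, inner_sub_right, inner_add_left, inner_add_right, hdd, hadd₁,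
          hadd₂]
        ring
      map_smul' := fun c x => by
        rw [← sub_eq_zero, ← inner_self_eq_zero (𝕜 := ℂ)]
        simp only [inner_sub_left, inner_sub_right, inner_smul_left, inner_smul_right, hdd,
          hsmul₁, hsmul₂, RingHom.id_apply]
        ring }
  refine ⟨D, fun ε hε => ?_⟩
  -- Expanding ‖δ h - D h‖² leaves one error from ⟨δ h, δ h⟩ and two from the cross terms, hence the
  -- division by 3.
  obtain ⟨ρ₁, hρ₁, hb₁⟩ := hS (ε ^ 2 / 3) (by positivity)
  obtain ⟨ρ₂, hρ₂, hb₂⟩ := hδd (ε ^ 2 / 3) (by positivity)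
  refine ⟨min ρ₁ ρ₂, lt_min hρ₁ hρ₂, fun h hh => ?_⟩
  rw [lt_min_iff] at hh
  have h1 := (Complex.abs_re_le_norm _).trans (hb₁ h h hh.1 hh.1)
  have h2 := (Complex.abs_re_le_norm _).trans (hb₂ h h hh.2)
  rw [Complex.sub_re, abs_le] at h1 h2
  refine le_of_sq_le_sq ?_ (by positivity)
  have h3 : (inner ℂ (D h) (δ h)).re = (inner ℂ (δ h) (d h)).re := by
    rw [← inner_conj_symm, Complex.conj_re]
    rfl
  have h4 : (inner ℂ (D h) (D h)).re = (S h h).re := congrArg Complex.re (hdd h h)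
  have h5 : (inner ℂ (δ h) (D h)).re = (inner ℂ (δ h) (d h)).re := rfl
  rw [hsq, h3, h4, h5]
  nlinarith

namespace CowenDouglas

open Metric Set Filter Topology SeveralComplexVariables

variable {m : ℕ}

/-- A map into a Hilbert space with sesquiholomorphic Gram kernel is holomorphic. -/
theorem differentiableAt_of_inner_eq {H : Type*} [NormedAddCommGroup H] [InnerProductSpace ℂ H]
    [CompleteSpace H] {γ : Cn m → H} {Φ : Cn m × Cn m → ℂ} {w : Cn m}
    (hΦ : ContDiffAt ℂ 2 Φ (w, conjVec w)) {V : Set (Cn m)} (hV : V ∈ 𝓝 w)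
    (hγ : ∀ v ∈ V, ∀ u ∈ V, inner ℂ (γ v) (γ u) = Φ (u, conjVec v)) :
    DifferentiableAt ℂ γ w := by
  obtain ⟨r, hr, hrV⟩ := Metric.mem_nhds_iff.mp hV
  have hmem : ∀ h : Cn m, ‖h‖ < r → w + h ∈ V := fun h hh => hrV (by simpa using hh)
  have hadd₁ : ∀ x y z : Cn m, mixedDeriv Φ (w, conjVec w) (x + y) z =
      mixedDeriv Φ (w, conjVec w) x z + mixedDeriv Φ (w, conjVec w) y z := by
    intro x y z
    simp only [mixedDeriv_eq hΦ]
    rw [show ((x + y, 0) : Cn m × Cn m) = (x, 0) + (y, 0) by simp, map_add, add_apply]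
  have hadd₂ : ∀ x y z : Cn m, mixedDeriv Φ (w, conjVec w) x (y + z) =
      mixedDeriv Φ (w, conjVec w) x y + mixedDeriv Φ (w, conjVec w) x z := by
    intro x y z
    simp only [mixedDeriv_eq hΦ]
    rw [show ((0, y + z) : Cn m × Cn m) = (0, y) + (0, z) by simp, map_add]
  -- Inner products of increments of γ are exactly mixed second differences of Φ, so the
  -- sesquilinear form is the mixed derivative, with the first argument entering through its
  -- conjugate.
  obtain ⟨D, hD⟩ := exists_linearMap_of_inner_expansion (δ := fun h => γ (w + h) - γ w)
    (S := fun k h => mixedDeriv Φ (w, conjVec w) h (conjVec k))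
    (fun x y z => by simp only [conjVec_add, hadd₂])
    (fun x y z => by simp only [hadd₁])
    (fun c x y => by
      have := mixedDeriv_smul_smul hΦ 1 (conj c) y (conjVec x)
      simp only [one_smul, one_mul] at this
      simp only [conjVec_smul, this, mul_comm])
    (fun c x y => by
      have := mixedDeriv_smul_smul hΦ c 1 y (conjVec x)
      simp only [one_smul, mul_one] at this
      exact this)
    (fun ε hε => by
      obtain ⟨ρ, hρ, hb⟩ := exists_norm_second_difference_le hΦ hε
      refine ⟨min ρ r, lt_min hρ hr, fun h k hh hk => ?_⟩
      rw [lt_min_iff] at hh hk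
      have h1 := hb k (conjVec h) hk.1 (by simpa using hh.1)
      have hw : w ∈ V := mem_of_mem_nhds hV
      rw [norm_conjVec] at h1
      simp only [inner_sub_left, inner_sub_right, hγ _ (hmem h hh.2) _ (hmem k hk.2),
        hγ _ (hmem h hh.2) _ hw, hγ _ hw _ (hmem k hk.2), hγ _ hw _ hw, conjVec_add]
      refine (le_of_eq ?_).trans (h1.trans (le_of_eq (by ring)))
      congr 1
      ring)
  refine HasFDerivAt.differentiableAt (f' := LinearMap.toContinuousLinearMap D) ?_
  rw [hasFDerivAt_iff_isLittleO_nhds_zero, Asymptotics.isLittleO_iff]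
  intro ε hε
  obtain ⟨ρ, hρ, hb⟩ := hD ε hε
  filter_upwards [ball_mem_nhds (0 : Cn m) hρ] with h hh
  exact hb h (by simpa using hh)

/-! ### Coordinate multiplications on a reproducing kernel Hilbert space -/

theorem IsPosDefKernel.diag_pos {K : Cn m → Cn m → ℂ} (hK : IsPosDefKernel (unitBall m) K)
    (hdiag : ∀ w ∈ unitBall m, K w w ≠ 0) {w : Cn m} (hw : w ∈ unitBall m) : 0 < K w w :=
  lt_of_le_of_ne (Matrix.PosSemidef.diag_nonneg hK (i := ⟨w, hw⟩)) (hdiag w hw).symm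

section Kernel

variable {K : Cn m → Cn m → ℂ} (hK : IsPosDefKernel (unitBall m) K)

/-- The kernel function `K(·, w)` as an element of the reproducing kernel Hilbert space. -/
noncomputable def kernelVec (w : unitBall m) : KernelSpace (unitBall m) K hK :=
  RKHS.kerFun (KernelSpace (unitBall m) K hK) w 1

theorem inner_kernelVec_kernelVec (z w : unitBall m) :
    inner ℂ (kernelVec hK z) (kernelVec hK w) = K z w :=
  KernelSpace.inner_kerFun_kerFun hK z w

theorem inner_kernelVec (w : unitBall m) (f : KernelSpace (unitBall m) K hK) :
    inner ℂ (kernelVec hK w) f = f w := by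
  rw [kernelVec, RKHS.kerFun_inner]
  simp

theorem kernelVec_apply (z w : unitBall m) : kernelVec hK w z = K z w := by
  rw [← inner_kernelVec, inner_kernelVec_kernelVec]

/-- By the reproducing property, pairing with f gives (T f)(w) = w_i f(w). The conjugated eigenvalue
is the reason for evaluating `kernelSection` at the conjugate point. -/
theorem adjoint_kernelVec {i : Fin m}
    {T : KernelSpace (unitBall m) K hK →L[ℂ] KernelSpace (unitBall m) K hK} (hT : IsCoordMul i T)
    (w : unitBall m) :
    ContinuousLinearMap.adjoint T (kernelVec hK w) = conj ((w : Cn m) i) • kernelVec hK w := by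
  refine ext_inner_right ℂ fun f => ?_
  rw [ContinuousLinearMap.adjoint_inner_left, inner_smul_left, inner_kernelVec, inner_kernelVec,
    hT, Complex.conj_conj]

theorem mem_jointKer_iff {H : Type*} [NormedAddCommGroup H] [InnerProductSpace ℂ H]
    {T : Fin m → H →L[ℂ] H} {w : Cn m} {x : H} : x ∈ jointKer T w ↔ ∀ i, T i x = w i • x := by
  rw [jointKer, LinearMap.mem_ker]
  simp only [jointD, ContinuousLinearMap.coe_coe, funext_iff, ContinuousLinearMap.pi_apply,
    sub_apply, smul_apply, ContinuousLinearMap.id_apply, Pi.zero_apply, sub_eq_zero]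

/-- The kernel function at `conj v`, extended by zero outside of the ball. -/
noncomputable def kernelSection (v : Cn m) : KernelSpace (unitBall m) K hK :=
  open scoped Classical in
  if h : conjVec v ∈ unitBall m then kernelVec hK ⟨conjVec v, h⟩ else 0

theorem kernelSection_eq {v : Cn m} (hv : v ∈ unitBall m) :
    kernelSection hK v = kernelVec hK ⟨conjVec v, conjVec_mem_ball.mpr hv⟩ :=
  dif_pos _

theorem inner_kernelSection {v u : Cn m} (hv : v ∈ unitBall m) (hu : u ∈ unitBall m) :
    inner ℂ (kernelSection hK v) (kernelSection hK u) = K (conjVec v) (conjVec u) := by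
  rw [kernelSection_eq hK hv, kernelSection_eq hK hu, inner_kernelVec_kernelVec]

/-- The Gram kernel K(v̄, ū) is anti-holomorphic in v and holomorphic in u, which suffices for norm
holomorphy. -/
theorem differentiableOn_kernelSection (hholo : SesquiHolomorphicOn (unitBall m) K) :
    DifferentiableOn ℂ (kernelSection hK) (unitBall m) := by
  intro w hw
  have hK' := sesquiHolomorphicOn_unitBall.mp hholo
  have hΦ : DifferentiableOn ℂ (fun p : Cn m × Cn m => K p.2 (conjVec p.1))
      (ball 0 1 ×ˢ ball 0 1) :=
    hK'.comp (f := fun p : Cn m × Cn m => (p.2, p.1)) (by fun_prop) fun p hp => ⟨hp.2, hp.1⟩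
  refine (differentiableAt_of_inner_eq
    (contDiffAt_of_mem_ball hΦ ⟨hw, conjVec_mem_ball.mpr hw⟩) (isOpen_ball.mem_nhds hw)
    fun v hv u hu => ?_).differentiableWithinAt
  exact inner_kernelSection hK hv hu

theorem isHolomorphicSection_kernelSection (hholo : SesquiHolomorphicOn (unitBall m) K)
    (hdiag : ∀ w ∈ unitBall m, K w w ≠ 0)
    {M : Fin m → KernelSpace (unitBall m) K hK →L[ℂ] KernelSpace (unitBall m) K hK}
    (hM : ∀ i, IsCoordMul i (M i)) :
    IsHolomorphicSection (adjointTuple M) (unitBall m) (kernelSection hK) where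
  isOpen := isOpen_ball
  holomorphic := differentiableOn_kernelSection hK hholo
  ne_zero w hw h0 := by
    have h1 := inner_kernelSection hK hw hw
    rw [h0, inner_zero_left] at h1
    exact hdiag _ (conjVec_mem_ball.mpr hw) h1.symm
  mem_ker w hw := by
    rw [mem_jointKer_iff]
    intro i
    rw [kernelSection_eq hK hw, adjointTuple, adjoint_kernelVec hK (hM i)]
    simp

end Kernel

end CowenDouglas

/-! ### Curvature in terms of the reproducing kernel -/

namespace CowenDouglas

open Metric Set Filter Topology SeveralComplexVariables

variable {m : ℕ}

theorem isOpen_log_domain {L : Cn m → Cn m → ℂ} (hL : SesquiHolomorphicOn (unitBall m) L) :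
    IsOpen (ball (0 : Cn m) 1 ×ˢ ball (0 : Cn m) 1 ∩
      (fun p : Cn m × Cn m => L p.1 (conjVec p.2)) ⁻¹' Complex.slitPlane) :=
  (sesquiHolomorphicOn_unitBall.mp hL).continuousOn.isOpen_inter_preimage
    (isOpen_ball.prod isOpen_ball) Complex.isOpen_slitPlane

theorem mem_log_domain {L : Cn m → Cn m → ℂ} (hpos : ∀ w ∈ unitBall m, 0 < L w w) {w : Cn m}
    (hw : w ∈ unitBall m) : (w, conjVec w) ∈ ball (0 : Cn m) 1 ×ˢ ball (0 : Cn m) 1 ∩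
      (fun p : Cn m × Cn m => L p.1 (conjVec p.2)) ⁻¹' Complex.slitPlane := by
  refine ⟨⟨hw, conjVec_mem_ball.mpr hw⟩, ?_⟩
  simp only [mem_preimage, conjVec_conjVec]
  exact mem_slitPlane_of_pos (hpos w hw)

theorem differentiableOn_log {L : Cn m → Cn m → ℂ} (hL : SesquiHolomorphicOn (unitBall m) L) :
    DifferentiableOn ℂ (fun p : Cn m × Cn m => Complex.log (L p.1 (conjVec p.2)))
      (ball (0 : Cn m) 1 ×ˢ ball (0 : Cn m) 1 ∩
        (fun p : Cn m × Cn m => L p.1 (conjVec p.2)) ⁻¹' Complex.slitPlane) :=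
  ((sesquiHolomorphicOn_unitBall.mp hL).mono inter_subset_left).clog fun _ hp => hp.2

/-- The sum of the two principal logarithms is holomorphic near the anti-diagonal, and there, both
values being positive, it restricts to the real logarithm of the product. No branch identity is
needed elsewhere. -/
theorem hessLog_mul {L₁ L₂ : Cn m → Cn m → ℂ} (h₁ : SesquiHolomorphicOn (unitBall m) L₁)
    (h₂ : SesquiHolomorphicOn (unitBall m) L₂) (hpos₁ : ∀ w ∈ unitBall m, 0 < L₁ w w)
    (hpos₂ : ∀ w ∈ unitBall m, 0 < L₂ w w) {w : Cn m} (hw : w ∈ unitBall m) :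
    hessLog (fun v => (L₁ v v * L₂ v v).re) w =
      hessLog (fun v => (L₁ v v).re) w + hessLog (fun v => (L₂ v v).re) w := by
  obtain ⟨hc₁, he₁⟩ := hessLog_eq_mixedMatrix_log h₁ hpos₁ hw
  obtain ⟨hc₂, he₂⟩ := hessLog_eq_mixedMatrix_log h₂ hpos₂ hw
  ext i j
  rw [hessLog_eq_mixedDeriv ((isOpen_log_domain h₁).inter (isOpen_log_domain h₂))
    ⟨mem_log_domain hpos₁ hw, mem_log_domain hpos₂ hw⟩
    (((differentiableOn_log h₁).mono inter_subset_left).add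
      ((differentiableOn_log h₂).mono inter_subset_right)) ?_, Matrix.add_apply, he₁, he₂]
  · exact mixedDeriv_add hc₁ hc₂ _ _
  · filter_upwards [isOpen_ball.mem_nhds hw] with v hv
    have p₁ := hpos₁ v hv
    have p₂ := hpos₂ v hv
    simp only [Pi.add_apply, conjVec_conjVec]
    rw [← ofReal_log_re p₁, ← ofReal_log_re p₂, ← Complex.ofReal_add,
      ← Real.log_mul (Complex.pos_iff.mp p₁).1.ne' (Complex.pos_iff.mp p₂).1.ne', Complex.mul_re,
      ← (Complex.pos_iff.mp p₁).2]
    simp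

/-- The complex Hessian of `log (|c|² K(v̄, v̄))` for a holomorphic function `c`. -/
theorem hessLog_conj_of_holomorphic_factor {K : Cn m → Cn m → ℂ}
    (hK : SesquiHolomorphicOn (unitBall m) K) (hpos : ∀ w ∈ unitBall m, 0 < K w w)
    {g : Cn m → ℝ} {c : Cn m → ℂ} {w : Cn m} (hw : w ∈ unitBall m)
    (hc : ∀ᶠ v in 𝓝 w, DifferentiableAt ℂ c v) (hcw : c w ≠ 0)
    (hg : ∀ᶠ v in 𝓝 w, g v = ‖c v‖ ^ 2 * (K (conjVec v) (conjVec v)).re) :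
    hessLog g w = (hessLog (fun v => (K v v).re) (conjVec w)).transpose := by
  have hw' : conjVec w ∈ unitBall m := conjVec_mem_ball.mpr hw
  obtain ⟨hcK, heK⟩ := hessLog_eq_mixedMatrix_log hK hpos hw'
  rw [conjVec_conjVec] at hcK heK
  set ψ : Cn m × Cn m → ℂ := fun p => Complex.log (K p.1 (conjVec p.2)) with hψ
  -- a holomorphic logarithm of `c / c w` near `w`
  have hslit : ∀ᶠ v in 𝓝 w, c v * (c w)⁻¹ ∈ Complex.slitPlane := by
    have h1 : ContinuousAt (fun v => c v * (c w)⁻¹) w := hc.self_of_nhds.continuousAt.mul_const _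
    refine h1.eventually (Complex.isOpen_slitPlane.mem_nhds ?_)
    beta_reduce
    rw [mul_inv_cancel₀ hcw]
    exact Complex.one_mem_slitPlane
  -- The constant restores Re p = log ‖c‖, so log ‖c‖² = p + conj p. This polarizes to a function of
  -- z plus a function of u, which the mixed derivative annihilates.
  set p : Cn m → ℂ := fun v => Complex.log (c v * (c w)⁻¹) + Real.log ‖c w‖ with hp
  obtain ⟨V, hV, hVo, hwV⟩ := _root_.mem_nhds_iff.mp (hc.and hslit)
  have hpd : ∀ v ∈ V, DifferentiableAt ℂ p v := fun v hv =>
    (((hV hv).1.mul_const _).clog (hV hv).2).add_const _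
  have hpd' : ∀ u ∈ conjVec ⁻¹' V, DifferentiableAt ℂ (fun u => conj (p (conjVec u))) u :=
    fun u hu => differentiableAt_conj_comp_conjVec (hpd _ hu)
  have hVo' : IsOpen (conjVec ⁻¹' V) := hVo.preimage continuous_conjVec
  have hwV' : conjVec w ∈ conjVec ⁻¹' V := by simpa using hwV
  have hd1 : DifferentiableOn ℂ (fun q : Cn m × Cn m => p q.1) (V ×ˢ (conjVec ⁻¹' V)) :=
    fun q hq => ((hpd q.1 hq.1).comp q differentiableAt_fst).differentiableWithinAt
  have hd2 : DifferentiableOn ℂ (fun q : Cn m × Cn m => conj (p (conjVec q.2)))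
      (V ×ˢ (conjVec ⁻¹' V)) := fun q hq =>
    ((hpd' q.2 hq.2).comp q differentiableAt_snd).differentiableWithinAt
  have hO := hVo.prod hVo'
  have hOw : (w, conjVec w) ∈ V ×ˢ (conjVec ⁻¹' V) := ⟨hwV, hwV'⟩
  have hdK : DifferentiableOn ℂ (fun q : Cn m × Cn m => ψ q.swap) (Prod.swap ⁻¹'
      (ball (0 : Cn m) 1 ×ˢ ball (0 : Cn m) 1 ∩
        (fun p : Cn m × Cn m => K p.1 (conjVec p.2)) ⁻¹' Complex.slitPlane)) :=
    (differentiableOn_log hK).comp (f := Prod.swap)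
      (differentiableOn_snd.prodMk differentiableOn_fst) fun q hq => hq
  have hOK := (isOpen_log_domain hK).preimage (continuous_swap (X := Cn m) (Y := Cn m))
  have hOKw : (w, conjVec w) ∈ Prod.swap ⁻¹' (ball (0 : Cn m) 1 ×ˢ ball (0 : Cn m) 1 ∩
      (fun p : Cn m × Cn m => K p.1 (conjVec p.2)) ⁻¹' Complex.slitPlane) := by
    have := mem_log_domain hpos hw'
    rwa [conjVec_conjVec] at this
  ext i j
  rw [hessLog_eq_mixedDeriv (hO.inter hOK) ⟨hOw, hOKw⟩
    (((hd1.add hd2).mono inter_subset_left).add (hdK.mono inter_subset_right)) ?_ i j,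
    Matrix.transpose_apply, heK]
  · have c1 := contDiffAt_of_differentiableOn hO 2 hd1 hOw
    have c2 := contDiffAt_of_differentiableOn hO 2 hd2 hOw
    have c3 := contDiffAt_of_differentiableOn hOK 2 hdK hOKw
    have e1 := mixedDeriv_fst (E₂ := Cn m) p (p := (w, conjVec w))
      (by filter_upwards [hVo.mem_nhds hwV] with v hv using hpd v hv)
      (EuclideanSpace.single i 1) (EuclideanSpace.single j 1)
    have e2 := mixedDeriv_snd (E₁ := Cn m) (fun u => conj (p (conjVec u))) (p := (w, conjVec w))
      (by filter_upwards [hVo'.mem_nhds hwV'] with v hv using hpd' v hv)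
      (((contDiffAt_of_differentiableOn hVo' 2
        (fun u hu => (hpd' u hu).differentiableWithinAt) hwV').fderiv_right
          (m := 1) (by norm_num)).differentiableAt one_ne_zero)
      (EuclideanSpace.single i 1) (EuclideanSpace.single j 1)
    have e3 := mixedDeriv_swap (p := (w, conjVec w)) hcK (EuclideanSpace.single i 1)
      (EuclideanSpace.single j 1)
    refine (mixedDeriv_add (c1.add c2) c3 _ _).trans ?_
    rw [e3]
    have e4 := mixedDeriv_add c1 c2 (EuclideanSpace.single i 1) (EuclideanSpace.single j 1)
    rw [e1, e2, add_zero] at e4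
    refine (congrArg (· + _) e4).trans ?_
    rw [zero_add]
    rfl
  · filter_upwards [hg, hVo.mem_nhds hwV, isOpen_ball.mem_nhds hw] with v hgv hv hvb
    have hKv := hpos _ (conjVec_mem_ball.mpr hvb)
    have hcv : c v ≠ 0 := by
      intro h0
      have := Complex.slitPlane_ne_zero (hV hv).2
      rw [h0, zero_mul] at this
      exact this rfl
    have hre : (p v).re = Real.log ‖c v‖ := by
      simp only [hp, Complex.add_re, Complex.log_re, Complex.ofReal_re, norm_mul, norm_inv]
      rw [Real.log_mul (norm_ne_zero_iff.mpr hcv) (inv_ne_zero (norm_ne_zero_iff.mpr hcw)),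
        Real.log_inv]
      ring
    have h2 : p v + conj (p v) = ((2 * Real.log ‖c v‖ : ℝ) : ℂ) := by
      rw [Complex.add_conj, hre]
    simp only [Pi.add_apply, conjVec_conjVec, Prod.swap_prod_mk, hψ]
    rw [h2, ← ofReal_log_re hKv, hgv, ← Complex.ofReal_add, Real.log_mul
      (pow_ne_zero 2 (norm_ne_zero_iff.mpr hcv)) (Complex.pos_iff.mp hKv).1.ne', Real.log_pow]
    norm_num

/-- The curvature of the adjoints of the coordinate multiplications. -/
theorem curvatureMatrix_adjointTuple {K : Cn m → Cn m → ℂ} (hK : IsPosDefKernel (unitBall m) K)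
    (hholo : SesquiHolomorphicOn (unitBall m) K) (hdiag : ∀ w ∈ unitBall m, K w w ≠ 0)
    {M : Fin m → KernelSpace (unitBall m) K hK →L[ℂ] KernelSpace (unitBall m) K hK}
    (hM : ∀ i, IsCoordMul i (M i))
    (hker : ∀ v ∈ unitBall m, ∀ x ∈ jointKer (adjointTuple M) v,
      ∃ c : ℂ, x = c • kernelSection hK v) {w : Cn m} (hw : w ∈ unitBall m) :
    curvatureMatrix (adjointTuple M) w =
      -(hessLog (fun v => (K v v).re) (conjVec w)).transpose := by
  have hpos : ∀ w ∈ unitBall m, 0 < K w w := fun w hw => hK.diag_pos hdiag hw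
  have hsec := isHolomorphicSection_kernelSection hK hholo hdiag hM
  have hloc : HasLocalSection (adjointTuple M) w := ⟨_, _, hw, hsec⟩
  rw [curvatureMatrix, dif_pos hloc]
  obtain ⟨U, hwU, hγ⟩ := hloc.choose_spec
  set γ := hloc.choose
  congr 1
  -- `γ = c k` with `c` the quotient of two holomorphic functions
  set a : Cn m → ℂ := fun v => inner ℂ (kernelSection hK w) (γ v) with ha
  set b : Cn m → ℂ := fun v => inner ℂ (kernelSection hK w) (kernelSection hK v) with hb
  have had : ∀ v ∈ U, DifferentiableAt ℂ a v := fun v hv =>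
    (innerSL ℂ (kernelSection hK w)).differentiableAt.comp v
      (hγ.holomorphic.differentiableAt (hγ.isOpen.mem_nhds hv))
  have hbd : ∀ v ∈ unitBall m, DifferentiableAt ℂ b v := fun v hv =>
    (innerSL ℂ (kernelSection hK w)).differentiableAt.comp v
      (hsec.holomorphic.differentiableAt (isOpen_ball.mem_nhds hv))
  have hbw : b w ≠ 0 := inner_self_ne_zero.mpr (hsec.ne_zero w hw)
  have hbne : ∀ᶠ v in 𝓝 w, b v ≠ 0 := (hbd w hw).continuousAt.eventually_ne hbw
  have hγk : ∀ v ∈ U, v ∈ unitBall m → b v ≠ 0 → γ v = (a v * (b v)⁻¹) • kernelSection hK v := by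
    intro v hvU hv hbv
    obtain ⟨c, hc⟩ := hker v hv _ (hγ.mem_ker v hvU)
    have h1 : a v = c * b v := by simp only [ha, hb, hc, inner_smul_right]
    rw [h1, mul_assoc, mul_inv_cancel₀ hbv, mul_one]
    exact hc
  refine hessLog_conj_of_holomorphic_factor hholo hpos (c := fun v => a v * (b v)⁻¹) hw ?_ ?_ ?_
  · filter_upwards [hγ.isOpen.mem_nhds hwU, isOpen_ball.mem_nhds hw, hbne] with v hvU hv hbv
    exact (had v hvU).mul ((hbd v hv).inv hbv)
  · intro h0
    have h1 := hγk w hwU hw hbw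
    rw [h0, zero_smul] at h1
    exact hγ.ne_zero w hwU h1
  · filter_upwards [hγ.isOpen.mem_nhds hwU, isOpen_ball.mem_nhds hw, hbne] with v hvU hv hbv
    rw [hγk v hvU hv hbv, norm_smul, mul_pow, ← inner_kernelSection hK hv hv]
    congr 1
    exact (inner_self_eq_norm_sq (𝕜 := ℂ) _).symm

/-! ### Joint kernels -/

theorem exists_smul_kernelSection_of_rank_one {K : Cn m → Cn m → ℂ}
    (hK : IsPosDefKernel (unitBall m) K)
    (hholo : SesquiHolomorphicOn (unitBall m) K) (hdiag : ∀ w ∈ unitBall m, K w w ≠ 0)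
    {M : Fin m → KernelSpace (unitBall m) K hK →L[ℂ] KernelSpace (unitBall m) K hK}
    (hM : ∀ i, IsCoordMul i (M i))
    (hrank : ∀ w ∈ unitBall m, Module.rank ℂ (jointKer (adjointTuple M) w) = (1 : ℕ))
    {v : Cn m} (hv : v ∈ unitBall m) {x : KernelSpace (unitBall m) K hK}
    (hx : x ∈ jointKer (adjointTuple M) v) : ∃ c : ℂ, x = c • kernelSection hK v := by
  have hsec := isHolomorphicSection_kernelSection hK hholo hdiag hM
  have h1 : Module.finrank ℂ (jointKer (adjointTuple M) v) = 1 :=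
    Module.finrank_eq_of_rank_eq (hrank v hv)
  have hne : (⟨kernelSection hK v, hsec.mem_ker v hv⟩ : jointKer (adjointTuple M) v) ≠ 0 :=
    fun h => hsec.ne_zero v hv (congrArg Subtype.val h)
  obtain ⟨c, hc⟩ := (finrank_eq_one_iff_of_nonzero' _ hne).mp h1 ⟨x, hx⟩
  exact ⟨c, (congrArg Subtype.val hc).symm⟩

theorem inner_eq_sum (w z : Cn m) : inner ℂ w z = ∑ i, z i * conj (w i) := by
  simp [PiLp.inner_apply]

theorem one_sub_inner_ne_zero {z w : Cn m} (hz : z ∈ unitBall m) (hw : w ∈ unitBall m) :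
    1 - inner ℂ w z ≠ 0 := by
  intro h0
  have h5 : inner ℂ w z = 1 := (sub_eq_zero.mp h0).symm
  have h6 := norm_inner_le_norm (𝕜 := ℂ) w z
  have hz' : ‖z‖ < 1 := mem_ball_zero_iff.mp hz
  have hw' : ‖w‖ < 1 := mem_ball_zero_iff.mp hw
  rw [h5, norm_one] at h6
  nlinarith [norm_nonneg z, norm_nonneg w]

theorem sesquiHolomorphicOn_one_sub_inner :
    SesquiHolomorphicOn (unitBall m) fun z w => 1 - inner ℂ w z := by
  rw [sesquiHolomorphicOn_unitBall]
  simp only [inner_eq_sum, conjVec_apply, Complex.conj_conj]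
  exact Differentiable.differentiableOn (by fun_prop)

theorem sesquiHolomorphicOn_druryArvesonKernel :
    SesquiHolomorphicOn (unitBall m) (druryArvesonKernel m) := by
  have h := sesquiHolomorphicOn_unitBall.mp (sesquiHolomorphicOn_one_sub_inner (m := m))
  rw [sesquiHolomorphicOn_unitBall]
  exact h.fun_inv fun p hp => one_sub_inner_ne_zero hp.1 (conjVec_mem_ball.mpr hp.2)

/-- On the Drury-Arveson space, `∑ R_i R_i^*` is the projection onto the functions vanishing at
the origin. -/
theorem sum_druryArvesonShift_adjoint (f : DruryArveson m) :
    ∑ i, druryArvesonShift m i (adjointTuple (druryArvesonShift m) i f) =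
      f - f ⟨0, mem_ball_self one_pos⟩ •
        kernelVec (isPosDefKernel_druryArveson m) ⟨0, mem_ball_self one_pos⟩ := by
  set hA := isPosDefKernel_druryArveson m
  set o : unitBall m := ⟨0, mem_ball_self one_pos⟩ with ho
  let A : DruryArveson m →L[ℂ] DruryArveson m :=
    ∑ i, (druryArvesonShift m i).comp (adjointTuple (druryArvesonShift m) i)
  let B : DruryArveson m →L[ℂ] DruryArveson m :=
    ContinuousLinearMap.id ℂ _ - (innerSL ℂ (kernelVec hA o)).smulRight (kernelVec hA o)
  have hA' : ∀ f, A f = ∑ i, druryArvesonShift m i (adjointTuple (druryArvesonShift m) i f) :=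
    fun f => by simp only [A, sum_apply, ContinuousLinearMap.comp_apply]
  have hB' : ∀ f, B f = f - f o • kernelVec hA o := fun f => by
    simp only [B, sub_apply, ContinuousLinearMap.id_apply, ContinuousLinearMap.smulRight_apply,
      innerSL_apply_apply, inner_kernelVec]
  rw [← hA', ← hB']
  -- Both sides are bounded operators, so kernel functions suffice. On these the claim is ⟨z, w⟩ /
  -- (1 - ⟨z, w⟩) = 1 / (1 - ⟨z, w⟩) - 1.
  refine DFunLike.congr_fun (ContinuousLinearMap.ext_on (s := {x | ∃ (w : unitBall m) (v : ℂ),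
    RKHS.kerFun (DruryArveson m) w v = x}) ?_ ?_) f
  · exact Submodule.dense_iff_topologicalClosure_eq_top.mpr (RKHS.kerFun_dense (DruryArveson m))
  · rintro _ ⟨w, v, rfl⟩
    have hv : RKHS.kerFun (DruryArveson m) w v = v • kernelVec hA w := by
      rw [kernelVec, ← map_smul, smul_eq_mul, mul_one]
    rw [hv, map_smul, map_smul]
    congr 1
    refine RKHS.ext fun z => ?_
    have hsum : ∀ (s : Finset (Fin m)) (g : Fin m → DruryArveson m),
        (∑ i ∈ s, g i) z = ∑ i ∈ s, g i z := fun s g => by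
      simp only [← inner_kernelVec hA, inner_sum]
    rw [hA', hB', hsum]
    have hterm : ∀ i, druryArvesonShift m i (adjointTuple (druryArvesonShift m) i
        (kernelVec hA w)) z = (z : Cn m) i * conj ((w : Cn m) i) * druryArvesonKernel m z w := by
      intro i
      rw [adjointTuple, adjoint_kernelVec hA (isCoordMul_druryArvesonShift m i),
        isCoordMul_druryArvesonShift m i, RKHS.coe_smul, Pi.smul_apply, kernelVec_apply,
        smul_eq_mul, mul_assoc]
    rw [Finset.sum_congr rfl fun i _ => hterm i, ← Finset.sum_mul, ← inner_eq_sum, RKHS.coe_sub,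
      RKHS.coe_smul, Pi.sub_apply, Pi.smul_apply, kernelVec_apply, kernelVec_apply,
      kernelVec_apply]
    have hne := one_sub_inner_ne_zero z.2 w.2
    simp only [druryArvesonKernel, ho, inner_zero_left, inner_zero_right, sub_zero, inv_one,
      smul_eq_mul, mul_one]
    field_simp
    ring

/-- On a joint eigenvector the formula for ∑ R_i R_i^* reads (∑ v_i z_i) x(z) = x(z) - x(0), and
solving for x(z) gives x(0) times the kernel function at v̄. -/
theorem exists_smul_kernelSection_druryArveson {v : Cn m} (hv : v ∈ unitBall m)
    {x : DruryArveson m} (hx : x ∈ jointKer (adjointTuple (druryArvesonShift m)) v) :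
    ∃ c : ℂ, x = c • kernelSection (isPosDefKernel_druryArveson m) v := by
  set hA := isPosDefKernel_druryArveson m
  set o : unitBall m := ⟨0, mem_ball_self one_pos⟩ with ho
  refine ⟨x o, RKHS.ext fun z => ?_⟩
  have h1 := sum_druryArvesonShift_adjoint x
  simp only [mem_jointKer_iff.mp hx, map_smul] at h1
  have h2 := congrArg (fun f : DruryArveson m => inner ℂ (kernelVec hA z) f) h1
  simp only [inner_sum, inner_sub_right, inner_smul_right, inner_kernelVec,
    isCoordMul_druryArvesonShift m _ x z, kernelVec_apply] at h2
  have h3 : ∑ i, v i * ((z : Cn m) i * x z) = inner ℂ (conjVec v) (z : Cn m) * x z := by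
    rw [inner_eq_sum, Finset.sum_mul]
    refine Finset.sum_congr rfl fun i _ => ?_
    rw [conjVec_apply, Complex.conj_conj]
    ring
  rw [h3] at h2
  have hne := one_sub_inner_ne_zero z.2 (conjVec_mem_ball.mpr hv)
  rw [RKHS.coe_smul, Pi.smul_apply, kernelSection_eq hA hv, kernelVec_apply, smul_eq_mul]
  simp only [druryArvesonKernel, inner_zero_left, sub_zero, inv_one, mul_one] at h2 ⊢
  rw [eq_mul_inv_iff_mul_eq₀ hne]
  linear_combination -h2

end CowenDouglas

/-! ### Comparison of curvatures through the defect kernel -/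

namespace CowenDouglas

open Metric Set Filter Topology SeveralComplexVariables

variable {m : ℕ}

/-- Positive definiteness is invariant under `G ↦ G(w̄)ᵀ`. -/
theorem IsPosDefFunction.conj_transpose {k : ℕ} {G G' : Cn m → Matrix (Fin k) (Fin k) ℂ}
    (hG : IsPosDefFunction (unitBall m) G)
    (h : ∀ w ∈ unitBall m, G' w = (G (conjVec w)).transpose) :
    IsPosDefFunction (unitBall m) G' := by
  obtain ⟨F, hF, hFd, hFpos⟩ := hG
  -- Conjugating the points reverses the holomorphy types and exchanging them restores these;
  -- positivity survives because the new kernel is the transpose of a reindexed positive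
  -- semidefinite one.
  refine ⟨fun z w => (F (conjVec w) (conjVec z)).transpose, fun i j => ?_, fun w hw => ?_, ?_⟩
  · rw [sesquiHolomorphicOn_unitBall]
    simp only [conjVec_conjVec, Matrix.transpose_apply]
    exact (sesquiHolomorphicOn_unitBall.mp (hF j i)).comp
      (f := fun p : Cn m × Cn m => (p.2, p.1)) (by fun_prop) fun p hp => ⟨hp.2, hp.1⟩
  · beta_reduce
    rw [h w hw, hFd _ (conjVec_mem_ball.mpr hw)]
  · have h1 := (hFpos.submatrix fun p : unitBall m × Fin k =>
      ((⟨conjVec p.1, conjVec_mem_ball.mpr p.1.2⟩ : unitBall m), p.2)).transpose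
    exact h1

theorem one_sub_inner_self_pos {w : Cn m} (hw : w ∈ unitBall m) : 0 < 1 - inner ℂ w w := by
  have hw' : ‖w‖ < 1 := mem_ball_zero_iff.mp hw
  rw [inner_self_eq_norm_sq_to_K]
  have h1 : (0 : ℝ) < 1 - ‖w‖ ^ 2 := by nlinarith [norm_nonneg w]
  have h2 := Complex.zero_lt_real.mpr h1
  push_cast at h2
  exact h2

theorem druryArvesonKernel_self_pos {w : Cn m} (hw : w ∈ unitBall m) :
    0 < druryArvesonKernel m w w :=
  (isPosDefKernel_druryArveson m).diag_pos
    (fun _ hv => inv_ne_zero (one_sub_inner_ne_zero hv hv)) hw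

/-- The kernel `(1 - ⟨z, w⟩) K(z, w)`. -/
noncomputable def defectKernel (K : Cn m → Cn m → ℂ) (z w : Cn m) : ℂ := (1 - inner ℂ w z) * K z w

theorem hessLog_congr {g₁ g₂ : Cn m → ℝ} {w : Cn m} (h : g₁ =ᶠ[𝓝 w] g₂) :
    hessLog g₁ w = hessLog g₂ w := by
  ext i j
  have hev : (fun v => ((Real.log (g₁ v) : ℝ) : ℂ)) =ᶠ[𝓝 w]
      fun v => ((Real.log (g₂ v) : ℝ) : ℂ) := by
    filter_upwards [h] with v hv
    rw [hv]
  have hbar : dWbar j (fun v => ((Real.log (g₁ v) : ℝ) : ℂ)) =ᶠ[𝓝 w]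
      dWbar j fun v => ((Real.log (g₂ v) : ℝ) : ℂ) := by
    filter_upwards [hev.eventually_nhds] with v hv
    rw [dWbar, dWbar, Filter.EventuallyEq.fderiv_eq hv]
  rw [hessLog, hessLog, Matrix.of_apply, Matrix.of_apply, dW, dW, hbar.fderiv_eq]

section Defect

variable {K : Cn m → Cn m → ℂ}

theorem sesquiHolomorphicOn_defectKernel (hholo : SesquiHolomorphicOn (unitBall m) K) :
    SesquiHolomorphicOn (unitBall m) (defectKernel K) :=
  DifferentiableOn.mul sesquiHolomorphicOn_one_sub_inner hholo

theorem defectKernel_self_pos (hK : IsPosDefKernel (unitBall m) K)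
    (hdiag : ∀ w ∈ unitBall m, K w w ≠ 0) {w : Cn m} (hw : w ∈ unitBall m) : 0 < defectKernel K w w :=
  mul_pos (one_sub_inner_self_pos hw) (hK.diag_pos hdiag hw)

theorem conj_defectKernel (hK : IsPosDefKernel (unitBall m) K) {z w : Cn m} (hz : z ∈ unitBall m)
    (hw : w ∈ unitBall m) : conj (defectKernel K w z) = defectKernel K z w := by
  have h1 : conj (K w z) = K z w := hK.1.apply (⟨z, hz⟩ : unitBall m) ⟨w, hw⟩
  simp only [defectKernel, map_mul, map_sub, map_one, inner_conj_symm, h1]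

/-- K is the product of the defect kernel and the Drury-Arveson kernel, and complex Hessians of
logarithms are additive. -/
theorem hessLog_eq_add (hK : IsPosDefKernel (unitBall m) K)
    (hholo : SesquiHolomorphicOn (unitBall m) K) (hdiag : ∀ w ∈ unitBall m, K w w ≠ 0) {w : Cn m} (hw : w ∈ unitBall m) :
    hessLog (fun v => (K v v).re) w = hessLog (fun v => (defectKernel K v v).re) w +
      hessLog (fun v => (druryArvesonKernel m v v).re) w := by
  rw [← hessLog_mul (sesquiHolomorphicOn_defectKernel hholo) sesquiHolomorphicOn_druryArvesonKernel
    (fun w hw => defectKernel_self_pos hK hdiag hw) (fun w hw => druryArvesonKernel_self_pos hw) hw]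
  refine hessLog_congr ?_
  filter_upwards [isOpen_ball.mem_nhds hw] with v hv
  have hne := one_sub_inner_ne_zero hv hv
  have h1 : defectKernel K v v * druryArvesonKernel m v v = K v v := by
    simp only [defectKernel, druryArvesonKernel]
    field_simp
  rw [h1]

/-- Both curvatures are minus transposed Hessians at w̄, and the Drury-Arveson contribution cancels.
This is the bridge between (i) and (ii). -/
theorem curvatureMatrix_sub_curvatureMatrix (hK : IsPosDefKernel (unitBall m) K)
    (hholo : SesquiHolomorphicOn (unitBall m) K) (hdiag : ∀ w ∈ unitBall m, K w w ≠ 0)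
    {M : Fin m → KernelSpace (unitBall m) K hK →L[ℂ] KernelSpace (unitBall m) K hK}
    (hM_mul : ∀ i, IsCoordMul i (M i)) (hM : MemCowenDouglas 1 (unitBall m) (adjointTuple M))
    {w : Cn m} (hw : w ∈ unitBall m) :
    curvatureMatrix (adjointTuple (druryArvesonShift m)) w - curvatureMatrix (adjointTuple M) w =
      (hessLog (fun v => (defectKernel K v v).re) (conjVec w)).transpose := by
  have h1 := curvatureMatrix_adjointTuple hK hholo hdiag hM_mul
    (fun v hv x hx => exists_smul_kernelSection_of_rank_one hK hholo hdiag hM_mul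
      hM.rank_ker hv hx) hw
  have h2 := curvatureMatrix_adjointTuple (isPosDefKernel_druryArveson m)
    sesquiHolomorphicOn_druryArvesonKernel
    (fun w hw => (druryArvesonKernel_self_pos hw).ne') (isCoordMul_druryArvesonShift m)
    (fun v hv x hx => exists_smul_kernelSection_druryArveson hv hx) hw
  rw [h1, h2, hessLog_eq_add hK hholo hdiag (conjVec_mem_ball.mpr hw), Matrix.transpose_add]
  abel

end Defect

end CowenDouglas

theorem mainTheorem5 (m : ℕ)
    (K : CowenDouglas.Cn m → CowenDouglas.Cn m → ℂ)
    (hK : CowenDouglas.IsPosDefKernel (CowenDouglas.unitBall m) K)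
    (hK_holo : CowenDouglas.SesquiHolomorphicOn (CowenDouglas.unitBall m) K)
    (hK_diag : ∀ w ∈ CowenDouglas.unitBall m, K w w ≠ 0)
    (M : Fin m → CowenDouglas.KernelSpace (CowenDouglas.unitBall m) K hK →L[ℂ]
      CowenDouglas.KernelSpace (CowenDouglas.unitBall m) K hK)
    (hM_mul : ∀ i, CowenDouglas.IsCoordMul i (M i))
    (hM : CowenDouglas.MemCowenDouglas 1 (CowenDouglas.unitBall m)
      (CowenDouglas.adjointTuple M)) :
    (CowenDouglas.IsPosDefFunction (CowenDouglas.unitBall m)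
        (CowenDouglas.hessLog fun w => ((1 - inner ℂ w w) * K w w).re) ↔
      CowenDouglas.PrecOn (CowenDouglas.unitBall m)
        (CowenDouglas.curvatureMatrix (CowenDouglas.adjointTuple M))
        (CowenDouglas.curvatureMatrix
          (CowenDouglas.adjointTuple (CowenDouglas.druryArvesonShift m)))) ∧
    (CowenDouglas.IsPosDefFunction (CowenDouglas.unitBall m)
        (CowenDouglas.hessLog fun w => ((1 - inner ℂ w w) * K w w).re) ↔
      CowenDouglas.IsInfinitelyDivisibleRowContraction K) := by
  have hcurv := fun w hw => CowenDouglas.curvatureMatrix_sub_curvatureMatrix hK hK_holo hK_diag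
    hM_mul hM (w := w) hw
  have hdiv : CowenDouglas.IsPosDefFunction (CowenDouglas.unitBall m)
      (CowenDouglas.hessLog fun w => (CowenDouglas.defectKernel K w w).re) ↔
      CowenDouglas.IsInfinitelyDivisible (CowenDouglas.unitBall m)
        (CowenDouglas.defectKernel K) :=
    ⟨CowenDouglas.isInfinitelyDivisible_of_isPosDefFunction
      (CowenDouglas.sesquiHolomorphicOn_defectKernel hK_holo)
      (fun z hz w hw => CowenDouglas.conj_defectKernel hK hz hw)
      (fun w hw => CowenDouglas.defectKernel_self_pos hK hK_diag hw),
    CowenDouglas.isPosDefFunction_of_isInfinitelyDivisible⟩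
  -- The operation G ↦ G(w̄)ᵀ is an involution, so the same invariance lemma serves in both
  -- directions.
  refine ⟨⟨fun h => h.conj_transpose hcurv, fun h => ?_⟩, hdiv⟩
  refine CowenDouglas.IsPosDefFunction.conj_transpose h fun w hw => ?_
  rw [hcurv _ (CowenDouglas.conjVec_mem_ball.mpr hw), CowenDouglas.conjVec_conjVec,
    Matrix.transpose_transpose]
  rfl
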